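/- **Corollary 2 (average delay of an MC-IS-DA network).** For every $n$, let $n$ common nodes be placed independently and uniformly on the unit square, and let every node be the source of one flow, whose destination is chosen uniformly among the other nodes, independently of everything else. Two nodes are one hop apart if their distance is at most the transmission range $r(n)$, where $\sqrt{\log n/(\pi n)}<r(n)\le K\sqrt{\log n/n}$ for all large $n$. The square is divided into $b=b_0^2$ equal square cells, $b_0\ge1$, with a base station at the centre of each; the stations are joined by a wired network without delay. Under $H$-max-hop routing ($H\ge1$) a packet whose destination is at most $H$ hops away is sent over a shortest multi-hop route (ad hoc mode); every other packet is sent to the base station of the source's cell and then from the base station of the destination's cell to the destination (infrastructure mode). The traffic in infrastructure mode is assumed not to vanish: $\pi H^2r(n)^2\le 1-\varepsilon$ for all large $n$, with a constant $\varepsilon>0$. On each hop of an ad hoc route a packet spends a time in $[c_1,c_2]$, with constants $0<c_1\le c_2$. A base station uses directional antennas of beamwidth $\theta\in(0,\pi]$ (flat-top model, steerable from slot to slot) and $C_I\ge1$ channels; two of its simultaneous transmissions do not conflict if they use different channels within the same sector (same beam), or if their beams do not overlap. An uplink (downlink) round of a base station is a TDMA schedule with the least number of slots in which each infrastructure flow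 with source (destination) in its cell is served once, by a beam that covers the node concerned, the transmissions of a slot being pairwise non-conflicting and involving different nodes. A packet in infrastructure mode spends one uplink and one downlink round. Slots have length $cb/n$, so that a base station which supports only one transmission at a time goes through the average number $n/b$ of nodes of a cell in the constant time $c>0$; queueing delay is ignored. Let $D$ be the average of the delays of one packet per flow, and $D_a$, $D_i$ the contributions to this average of the packets in ad hoc and in infrastructure mode. The quantities $H,b_0,C_I,\theta$ may be fixed or depend on $n$, provided that $b\lfloor 2\pi/\theta\rfloor C_I\log n/n\to0$ (automatic if $b,C_I,\theta$ are fixed). Then the largest number of simultaneous, pairwise non-conflicting transmissions of a base station is $\lfloor 2\pi/\theta\rfloor\cdot C_I$, and, with probability tending to $1$ as $n\to\infty$, $D=D_a+D_i$ with $$D_a=\Theta\Big(\frac{H^3\log n}{n}\Big),\qquad D_i=\Theta\Big(\frac{c}{\lfloor 2\pi/\theta\rfloor\cdot C_I}\Big),$$ where the constants implied by $\Theta$ depend only on $K,\varepsilon,c_1,c_2$. -/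

import Mathlib

open Real Set Filter Topology MeasureTheory ProbabilityTheory

noncomputable section

/-- A realisation of the random network with `n` common nodes: the positions of the nodes in the
plane (identified with `ℂ`), and the destination of the flow that originates at each node. -/
abbrev Net (n : ℕ) : Type := (Fin n → ℂ) × (Fin n → Fin n)

/-- The unit square. -/
def unitSquare : Set ℂ := Set.Ico (0 : ℝ) 1 ×ℂ Set.Ico (0 : ℝ) 1

/-- The law of the network: the nodes are independent and uniform on the unit square (which has
area one); the destination of every node is uniform among the other nodes, and the destinations
are independent of one another and of the positions. -/
def netLaw (n : ℕ) : Measure (Net n) :=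
  (Measure.pi fun _ : Fin n => (volume : Measure ℂ).restrict unitSquare).prod
    (Measure.pi fun i : Fin n => uniformOn {j : Fin n | j ≠ i})

/-! ### Routing and ad hoc communications -/

/-- Two common nodes are joined by a single hop when their distance is at most the transmission
range `r` (each of the two turns its directional antenna towards the other one). -/
def hopGraph {n : ℕ} (r : ℝ) (x : Fin n → ℂ) : SimpleGraph (Fin n) where
  Adj u v := u ≠ v ∧ dist (x u) (x v) ≤ r
  symm := ⟨fun _ _ h => ⟨h.1.symm, by rw [dist_comm]; exact h.2⟩⟩
  loopless := ⟨fun _ h => h.1 rfl⟩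

/-- `H`-max-hop routing: the flow of node `i` is carried in ad hoc mode if and only if its
destination is at most `H` hops away. -/
def IsAdHoc {n : ℕ} (r : ℝ) (H : ℕ) (ω : Net n) (i : Fin n) : Prop :=
  (hopGraph r ω.1).edist i (ω.2 i) ≤ (H : ℕ∞)

/-- Delay of a packet of flow `i` in ad hoc mode: it follows a route with the least number of
hops, and `dwell i k` is the time that it spends on hop `k`. -/
def adHocPacketDelay {n : ℕ} (r : ℝ) (dwell : Fin n → ℕ → ℝ) (ω : Net n) (i : Fin n) : ℝ :=
  ∑ k ∈ Finset.range ((hopGraph r ω.1).dist i (ω.2 i)), dwell i k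

/-! ### Base stations with directional antennas -/

/-- The flat-top beam of width `θ` centred at the direction `β`. -/
def beam (θ : ℝ) (β : Real.Angle) : Set Real.Angle := {α | |(α - β).toReal| < θ / 2}

/-- A transmission at a base station uses an antenna pointed at the direction `p.1` and the channel
`p.2`, one of `C` channels. Two simultaneous transmissions do not conflict if they belong to
the same sector (same direction) and use different channels, or if they belong to two sectors
whose beams do not overlap. -/
def NoConflict {C : ℕ} (θ : ℝ) (p q : Real.Angle × Fin C) : Prop :=
  (p.1 = q.1 ∧ p.2 ≠ q.2) ∨ Disjoint (beam θ p.1) (beam θ q.1)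

/-- The numbers of simultaneous, pairwise non-conflicting transmissions that a base station with
antennas of beamwidth `θ` and with `C` channels can support. -/
def simultaneous (θ : ℝ) (C : ℕ) : Set ℕ :=
  {k | ∃ L : Finset (Real.Angle × Fin C),
    (∀ p ∈ L, ∀ q ∈ L, p ≠ q → NoConflict θ p q) ∧ L.card = k}

/-- The (index of the) BS-cell of a point: the square is divided into `b₀ * b₀` equal cells. -/
def cellOf (b₀ : ℕ) (z : ℂ) : ℕ × ℕ := (⌊b₀ * z.re⌋₊, ⌊b₀ * z.im⌋₊)

/-- The base station at the centre of a BS-cell. -/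
def station (b₀ : ℕ) (q : ℕ × ℕ) : ℂ := ⟨(q.1 + 1 / 2) / b₀, (q.2 + 1 / 2) / b₀⟩

/-- A TDMA round of `T` slots at the base station located at `s`, which serves each of the flows in
`F` once. The flow `i` is exchanged with the node `v i` located at `x (v i)`, in the slot `slot i`
and by the transmission `link i`, whose beam has to cover that node. Flows served in the same slot
involve different nodes (each node has a single interface) and do not conflict. -/
def HasRound {n : ℕ} (θ : ℝ) (C : ℕ) (s : ℂ) (x : Fin n → ℂ) (v : Fin n → Fin n)
    (F : Set (Fin n)) (T : ℕ) : Prop :=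
  ∃ (slot : Fin n → ℕ) (link : Fin n → Real.Angle × Fin C),
    (∀ i ∈ F, slot i < T ∧ ((x (v i) - s).arg : Real.Angle) ∈ beam θ (link i).1) ∧
    ∀ i ∈ F, ∀ j ∈ F, i ≠ j → slot i = slot j →
      v i ≠ v j ∧ NoConflict θ (link i) (link j)

/-- The least number of slots of such a round. -/
def roundLength {n : ℕ} (θ : ℝ) (C : ℕ) (s : ℂ) (x : Fin n → ℂ) (v : Fin n → Fin n)
    (F : Set (Fin n)) : ℕ :=
  sInf {T | HasRound θ C s x v F T}

/-- Uplink round of the base station of the cell `q`: it serves the infrastructure flows whose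
source lies in the cell. -/
def uplinkRound {n : ℕ} (r : ℝ) (H b₀ C : ℕ) (θ : ℝ) (ω : Net n) (q : ℕ × ℕ) : ℕ :=
  roundLength θ C (station b₀ q) ω.1 id {i | ¬ IsAdHoc r H ω i ∧ cellOf b₀ (ω.1 i) = q}

/-- Downlink round of the base station of the cell `q`: it serves the infrastructure flows whose
destination lies in the cell. -/
def downlinkRound {n : ℕ} (r : ℝ) (H b₀ C : ℕ) (θ : ℝ) (ω : Net n) (q : ℕ × ℕ) : ℕ :=
  roundLength θ C (station b₀ q) ω.1 ω.2
    {i | ¬ IsAdHoc r H ω i ∧ cellOf b₀ (ω.1 (ω.2 i)) = q}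

/-- Length of a slot at a base station (fluid model: the packet size is scaled with the number
`n / b₀ ^ 2` of nodes per cell). A station that supports one transmission at a time, on a single
channel, goes through `n / b₀ ^ 2` nodes in the time `c`. The constant factor by which neighbouring
BS-cells take turns to be active, which does not depend on the number of cells, is part of `c`. -/
def slotLength (n b₀ : ℕ) (c : ℝ) : ℝ := c * (b₀ : ℝ) ^ 2 / n

/-- Delay of a packet of flow `i` in infrastructure mode: one uplink round at the base station of
the source and one downlink round at the base station of the destination. The wired network
between the base stations causes no delay. -/
def infraPacketDelay {n : ℕ} (r : ℝ) (H b₀ C : ℕ) (θ c : ℝ) (ω : Net n) (i : Fin n) : ℝ :=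
  (uplinkRound r H b₀ C θ ω (cellOf b₀ (ω.1 i)) +
    downlinkRound r H b₀ C θ ω (cellOf b₀ (ω.1 (ω.2 i)))) * slotLength n b₀ c

/-! ### Average delay -/

open Classical in
/-- Average delay of all packets. -/
def avgDelay {n : ℕ} (r : ℝ) (H b₀ C : ℕ) (θ c : ℝ) (dwell : Fin n → ℕ → ℝ) (ω : Net n) : ℝ :=
  (∑ i, if IsAdHoc r H ω i then adHocPacketDelay r dwell ω i
    else infraPacketDelay r H b₀ C θ c ω i) / n

open Classical in
/-- The part of the average delay contributed by ad hoc communications. -/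
def avgDelayAdHoc {n : ℕ} (r : ℝ) (H : ℕ) (dwell : Fin n → ℕ → ℝ) (ω : Net n) : ℝ :=
  (∑ i, if IsAdHoc r H ω i then adHocPacketDelay r dwell ω i else 0) / n

open Classical in
/-- The part of the average delay contributed by infrastructure communications. -/
def avgDelayInfra {n : ℕ} (r : ℝ) (H b₀ C : ℕ) (θ c : ℝ) (ω : Net n) : ℝ :=
  (∑ i, if IsAdHoc r H ω i then 0 else infraPacketDelay r H b₀ C θ c ω i) / n

end

/-! ### Chernoff bounds for independent trials -/

/-! Every delay is squeezed between constant multiples of numbers of nodes or flows, and these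
numbers are controlled by Chernoff bounds (`measure_pi_chernoff`): for the positions, then for the
destinations given the positions. The conditioned events see the positions only through the cells of
a grid, so they are measurable and their bounds are uniform in the cell pattern
(`netLaw_le_of_conditional`). Events about delays are compared with these by monotonicity of the
outer measure.

Ad hoc part. About `n * H^2 * r^2`, that is `H^2 * log n`, flows have their destination within `H`
hops; each is delayed by a time of order `H`, and division by `n` gives `H^3 * log n / n`. The upper
bound is geometric: `H` hops reach no further than `H * r`. The lower bound has to produce routes.
As `r` may be barely above the connectivity threshold, cells of side about `r / 3` are only
guaranteed a mean of `log n / 51` nodes, and one cannot expect all of them to be occupied. But in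
blocks of `2ℓ × 2ℓ` cells, `ℓ ≥ 500` fixed, fewer than `ℓ` cells are bad (`netLaw_badCells`). Each
block then has a clean row and a clean column, and neighbouring blocks have a common clean line, so
hubs are joined by routes of length proportional to the distance of their blocks (`exists_hubs`).
Counting pairs of nodes in hub cells gives `sum_longRoutes_ge`.

Infrastructure part. Let `M = ⌊2π/θ⌋ * C`. Disjoint beams fit at most `⌊2π/θ⌋` times on the circle,
so a round serving `N` flows lasts at least `N / M` slots. Since a disc of radius `H * r` misses a
fixed proportion of the square, a fixed proportion of the flows use the stations, and Cauchy–Schwarz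
over the cells gives the lower bound (`le_avgDelayInfra`). For the upper bound, the circle is cut
into `2⌊2π/θ⌋` sectors narrower than a beam; beams aimed at sectors of equal parity are disjoint, so
two phases serve all sectors, with a wrap-around schedule inside each (`exists_slots`,
`roundLength_le`). The load hypothesis makes `n / (b * M)` large compared with `log n`, so that no
sector is overloaded by more than a constant factor. -/

theorem ncard_setOf_eq_sum_indicator {ι : Type*} [Fintype ι] {α : ι → Type*} (A : ∀ i, Set (α i))
    (ω : ∀ i, α i) :
    (({i | ω i ∈ A i} : Set ι).ncard : ℝ) = ∑ i, (A i).indicator (fun _ => (1 : ℝ)) (ω i) := by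
  classical
  rw [Set.ncard_eq_toFinset_card', Finset.card_eq_sum_ones, Nat.cast_sum]
  rw [Set.toFinset_ofPred, Finset.sum_filter]
  refine Finset.sum_congr rfl fun i _ => ?_
  by_cases h : ω i ∈ A i <;> simp [h]

theorem integral_exp_mul_indicator {α : Type*} [MeasurableSpace α] (μ : Measure α)
    [IsProbabilityMeasure μ] {A : Set α} (hA : MeasurableSet A) (t : ℝ) :
    ∫ x, rexp (t * A.indicator (fun _ => (1 : ℝ)) x) ∂μ = 1 + (rexp t - 1) * μ.real A := by
  have h : (fun x => rexp (t * A.indicator (fun _ => (1 : ℝ)) x)) =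
      fun x => 1 + A.indicator (fun _ => rexp t - 1) x := by
    funext x
    by_cases hx : x ∈ A <;> simp [hx]
  rw [h, integral_add (integrable_const _) ((integrable_const _).indicator hA),
    integral_indicator_const _ hA]
  simp [mul_comm]

/-- Exponential Markov inequality: the moment generating function factors over the trials, and `1 +
u ≤ exp u` bounds each factor. Both signs of `t` are allowed, so both tails follow. -/
theorem measure_pi_chernoff {ι : Type*} [Fintype ι] {α : ι → Type*} [∀ i, MeasurableSpace (α i)]
    (μ : ∀ i, Measure (α i)) [∀ i, IsProbabilityMeasure (μ i)] (A : ∀ i, Set (α i))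
    (hA : ∀ i, MeasurableSet (A i)) (t a : ℝ) :
    Measure.pi μ {ω | a ≤ t * ({i | ω i ∈ A i} : Set ι).ncard} ≤
      ENNReal.ofReal (rexp ((rexp t - 1) * ∑ i, (μ i).real (A i) - a)) := by
  have hprod : ∀ ω : ∀ i, α i, rexp (t * ({i | ω i ∈ A i} : Set ι).ncard) =
      ∏ i, rexp (t * (A i).indicator (fun _ => (1 : ℝ)) (ω i)) := by
    intro ω
    rw [ncard_setOf_eq_sum_indicator, Finset.mul_sum, Real.exp_sum]
  have hmeas : Measurable fun ω : ∀ i, α i => t * (({i | ω i ∈ A i} : Set ι).ncard : ℝ) := by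
    simp_rw [ncard_setOf_eq_sum_indicator]
    refine Measurable.const_mul (Finset.measurable_sum _ fun i _ => ?_) _
    exact (measurable_const.indicator (hA i)).comp (measurable_pi_apply i)
  have hint : Integrable (fun ω : ∀ i, α i => rexp (1 * (t * ({i | ω i ∈ A i} : Set ι).ncard)))
      (Measure.pi μ) := by
    refine Integrable.of_bound (C := rexp (|t| * Fintype.card ι))
      ((measurable_exp.comp (hmeas.const_mul 1)).aestronglyMeasurable) (ae_of_all _ fun ω => ?_)
    rw [Real.norm_eq_abs, abs_of_pos (exp_pos _), one_mul]
    refine exp_le_exp.mpr ?_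
    have hle : (({i | ω i ∈ A i} : Set ι).ncard : ℝ) ≤ Fintype.card ι := by
      rw [← Nat.card_eq_fintype_card]
      exact_mod_cast Set.ncard_le_card _
    calc t * (({i | ω i ∈ A i} : Set ι).ncard : ℝ) ≤ |t| * ({i | ω i ∈ A i} : Set ι).ncard := by
          gcongr
          exact le_abs_self t
      _ ≤ _ := by gcongr
  have hch := measure_ge_le_exp_mul_mgf (μ := Measure.pi μ) a zero_le_one hint
  have hmgf : mgf (fun ω : ∀ i, α i => t * (({i | ω i ∈ A i} : Set ι).ncard : ℝ)) (Measure.pi μ) 1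
      ≤ rexp ((rexp t - 1) * ∑ i, (μ i).real (A i)) := by
    simp only [mgf, one_mul, hprod]
    rw [integral_fintype_prod_eq_prod (fun i x => rexp (t * (A i).indicator (fun _ => (1 : ℝ)) x)),
      Finset.mul_sum, Real.exp_sum]
    refine Finset.prod_le_prod (fun i _ => integral_nonneg fun x => (exp_pos _).le) fun i _ => ?_
    rw [integral_exp_mul_indicator _ (hA i)]
    linarith [add_one_le_exp ((rexp t - 1) * (μ i).real (A i))]
  rw [← ENNReal.ofReal_toReal (measure_ne_top (Measure.pi μ) _)]
  refine ENNReal.ofReal_le_ofReal (hch.trans ?_)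
  calc rexp (-1 * a) * mgf (fun ω : ∀ i, α i => t * (({i | ω i ∈ A i} : Set ι).ncard : ℝ))
        (Measure.pi μ) 1 ≤ rexp (-1 * a) * rexp ((rexp t - 1) * ∑ i, (μ i).real (A i)) := by gcongr
    _ = _ := by rw [← exp_add]; ring_nf

/-- The choice `t = 1` suffices because `(e - 1) - 4 < -2`. Only an upper bound `m` on the mean is
needed. -/
theorem measure_pi_four_mul_le {ι : Type*} [Fintype ι] {α : ι → Type*}
    [∀ i, MeasurableSpace (α i)]
    (μ : ∀ i, Measure (α i)) [∀ i, IsProbabilityMeasure (μ i)] (A : ∀ i, Set (α i))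
    (hA : ∀ i, MeasurableSet (A i)) {m : ℝ} (hm : ∑ i, (μ i).real (A i) ≤ m) :
    Measure.pi μ {ω | 4 * m ≤ ({i | ω i ∈ A i} : Set ι).ncard} ≤ ENNReal.ofReal (rexp (-2 * m)) := by
  have h := measure_pi_chernoff μ A hA 1 (4 * m)
  simp only [one_mul] at h
  refine h.trans (ENNReal.ofReal_le_ofReal (exp_le_exp.mpr ?_))
  have h0 : 0 ≤ ∑ i, (μ i).real (A i) := Finset.sum_nonneg fun i _ => measureReal_nonneg
  have he := exp_one_lt_d9
  nlinarith [exp_one_gt_d9]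

/-- With `t = -1` and `1 / e ≤ 1 / 2`, the exponent is at most `-m / 2 + m / 4`. -/
theorem measure_pi_le_quarter {ι : Type*} [Fintype ι] {α : ι → Type*}
    [∀ i, MeasurableSpace (α i)]
    (μ : ∀ i, Measure (α i)) [∀ i, IsProbabilityMeasure (μ i)] (A : ∀ i, Set (α i))
    (hA : ∀ i, MeasurableSet (A i)) {m : ℝ} (hm0 : 0 ≤ m) (hm : m ≤ ∑ i, (μ i).real (A i)) :
    Measure.pi μ {ω | (({i | ω i ∈ A i} : Set ι).ncard : ℝ) ≤ m / 4} ≤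
      ENNReal.ofReal (rexp (-(m / 4))) := by
  have h := measure_pi_chernoff μ A hA (-1) (-(m / 4))
  refine (measure_mono fun ω hω => ?_).trans
    (h.trans (ENNReal.ofReal_le_ofReal (exp_le_exp.mpr ?_)))
  · simp only [Set.mem_ofPred_eq] at hω ⊢
    linarith
  · have h1 : rexp (-1) ≤ 1 / 2 := by
      rw [exp_neg, inv_eq_one_div]
      exact one_div_le_one_div_of_le two_pos (by linarith [exp_one_gt_d9])
    nlinarith

/-! ### Uniform destinations -/

theorem isProbabilityMeasure_uniformOn_ne {n : ℕ} (hn : 2 ≤ n) (i : Fin n) :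
    IsProbabilityMeasure (uniformOn {j : Fin n | j ≠ i}) := by
  refine isProbabilityMeasure_uniformOn (Set.toFinite _) ?_
  have : Nontrivial (Fin n) := Fin.nontrivial_iff_two_le.mpr hn
  exact exists_ne i

theorem uniformOn_ne_real {n : ℕ} (i : Fin n) (A : Set (Fin n)) :
    (uniformOn {j : Fin n | j ≠ i}).real A = ((A \ {i}).ncard : ℝ) / ((n : ℝ) - 1) := by
  classical
  have h1 : ({j : Fin n | j ≠ i} : Set (Fin n)) = ((Finset.univ.erase i : Finset (Fin n)) : Set _) := by
    ext; simp
  have h2 : A = (A.toFinset : Set (Fin n)) := by simp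
  have hn : 1 ≤ n := (Nat.zero_le i).trans_lt i.2
  rw [h1, measureReal_def, h2, uniformOn_apply_finset]
  have h3 : Finset.univ.erase i ∩ A.toFinset = (A \ {i}).toFinset := by
    ext; simp [and_comm]
  rw [h3, Set.ncard_eq_toFinset_card', Finset.card_erase_of_mem (Finset.mem_univ _),
    ENNReal.toReal_div, Finset.card_univ, Fintype.card_fin, ENNReal.toReal_natCast,
    ENNReal.toReal_natCast, Nat.cast_sub hn, Nat.cast_one, Set.toFinset_sdiff]
  simp

/-! ### Conditioning the network on the positions -/

/-- The discretized network takes countably many values, so `T` may be arbitrary. This disposes of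
the measurability of events that involve hop distances. -/
theorem measurableSet_of_discretization {n : ℕ} {ι : Type*} [Countable ι] [MeasurableSpace ι]
    [MeasurableSingletonClass ι] {κ : ℂ → ι} (hκ : Measurable κ)
    (T : Set ((Fin n → ι) × (Fin n → Fin n))) :
    MeasurableSet {ω : Net n | ((fun i => κ (ω.1 i)), ω.2) ∈ T} := by
  have h : Measurable fun ω : Net n => ((fun i => κ (ω.1 i)), ω.2) :=
    (measurable_pi_lambda _ fun i => hκ.comp ((measurable_pi_apply i).comp measurable_fst)).prodMk
      measurable_snd
  exact h (Set.to_countable T).measurableSet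

theorem volume_unitSquare : (volume : Measure ℂ) unitSquare = 1 := by
  have h := Complex.volume_preserving_equiv_real_prod.measure_preimage_equiv
    ((Set.Ico (0 : ℝ) 1) ×ˢ (Set.Ico (0 : ℝ) 1))
  have h2 : Complex.measurableEquivRealProd ⁻¹' ((Set.Ico (0 : ℝ) 1) ×ˢ (Set.Ico (0 : ℝ) 1)) =
      unitSquare := by
    ext z; simp [unitSquare, Complex.mem_reProdIm]
  rw [h2] at h
  rw [h, Measure.volume_eq_prod, Measure.prod_prod]
  simp

instance isProbabilityMeasure_restrict_unitSquare :
    IsProbabilityMeasure ((volume : Measure ℂ).restrict unitSquare) :=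
  ⟨by rw [Measure.restrict_apply_univ, volume_unitSquare]⟩

/-- Equality fails for `n = 1`: no destination is available and `netLaw` is the zero measure. `S` is
arbitrary, the bound being one of outer measures. -/
theorem netLaw_positions_le {n : ℕ} (S : Set (Fin n → ℂ)) :
    netLaw n {ω | ω.1 ∈ S} ≤
      Measure.pi (fun _ : Fin n => (volume : Measure ℂ).restrict unitSquare) S := by
  have h : {ω : Net n | ω.1 ∈ S} = S ×ˢ (Set.univ : Set (Fin n → Fin n)) := by ext; simp
  rw [h, netLaw, Measure.prod_prod]
  rcases lt_or_ge n 2 with hn | hn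
  · refine mul_le_of_le_one_right zero_le ?_
    interval_cases n
    · rw [Measure.pi_univ]; simp
    · rw [Measure.pi_univ]
      have : ({j : Fin 1 | j ≠ 0} : Set (Fin 1)) = ∅ := by ext j; simp [Subsingleton.elim j 0]
      simp [this]
  · have := fun i : Fin n => isProbabilityMeasure_uniformOn_ne hn i
    simp

/-- If the conditional probability of an event, given the positions of the nodes, is uniformly
bounded, and the event depends on the positions only through a discretization, then the bound
holds unconditionally. -/
theorem netLaw_le_of_conditional {n : ℕ} {ι : Type*} [Countable ι] [MeasurableSpace ι]
    [MeasurableSingletonClass ι] {κ : ℂ → ι} (hκ : Measurable κ)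
    (T : Set ((Fin n → ι) × (Fin n → Fin n))) {δ : ENNReal}
    (h : ∀ y : Fin n → ι, (Measure.pi fun i : Fin n => uniformOn {j : Fin n | j ≠ i})
      {d | (y, d) ∈ T} ≤ δ) :
    netLaw n {ω : Net n | ((fun i => κ (ω.1 i)), ω.2) ∈ T} ≤ δ := by
  rw [netLaw, Measure.prod_apply (measurableSet_of_discretization hκ T)]
  refine (lintegral_mono (g := fun _ => δ) fun x : Fin n → ℂ => h (fun i => κ (x i))).trans ?_
  simp

/-- Upper tail for the number of flows whose destination belongs to a set that depends on the
(discretized) positions. -/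
theorem netLaw_flows_upper {n : ℕ} (hn : 2 ≤ n) {ι : Type*} [Countable ι] [MeasurableSpace ι]
    [MeasurableSingletonClass ι] {κ : ℂ → ι} (hκ : Measurable κ) (A : (Fin n → ι) → Prop)
    (G : (Fin n → ι) → Fin n → Set (Fin n)) {m : ℝ}
    (hG : ∀ y, A y → ∑ i, ((G y i).ncard : ℝ) ≤ m * (n - 1)) :
    netLaw n {ω : Net n | A (fun i => κ (ω.1 i)) ∧
      4 * m ≤ ({i | ω.2 i ∈ G (fun i => κ (ω.1 i)) i} : Set (Fin n)).ncard} ≤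
      ENNReal.ofReal (rexp (-2 * m)) := by
  have := fun i : Fin n => isProbabilityMeasure_uniformOn_ne hn i
  refine netLaw_le_of_conditional hκ
    {p | A p.1 ∧ 4 * m ≤ ({i | p.2 i ∈ G p.1 i} : Set (Fin n)).ncard} fun y => ?_
  by_cases hy : A y
  · simp only [Set.mem_ofPred_eq, hy, true_and]
    refine measure_pi_four_mul_le _ (G y) (fun i => (Set.toFinite _).measurableSet) ?_
    simp_rw [uniformOn_ne_real]
    have hn1 : (0 : ℝ) < n - 1 := by
      have : (2 : ℝ) ≤ n := by exact_mod_cast hn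
      linarith
    rw [← Finset.sum_div, div_le_iff₀ hn1]
    refine (Finset.sum_le_sum fun i _ => ?_).trans (hG y hy)
    exact_mod_cast Set.ncard_le_ncard Set.sdiff_subset (Set.toFinite _)
  · simp [hy]

/-- Lower tail for the number of flows whose destination belongs to a set that depends on the
(discretized) positions. -/
theorem netLaw_flows_lower {n : ℕ} (hn : 2 ≤ n) {ι : Type*} [Countable ι] [MeasurableSpace ι]
    [MeasurableSingletonClass ι] {κ : ℂ → ι} (hκ : Measurable κ) (A : (Fin n → ι) → Prop)
    (G : (Fin n → ι) → Fin n → Set (Fin n)) {m : ℝ} (hm : 0 ≤ m)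
    (hG : ∀ y, A y → m * n ≤ ∑ i, ((G y i \ {i}).ncard : ℝ)) :
    netLaw n {ω : Net n | A (fun i => κ (ω.1 i)) ∧
      (({i | ω.2 i ∈ G (fun i => κ (ω.1 i)) i} : Set (Fin n)).ncard : ℝ) ≤ m / 4} ≤
      ENNReal.ofReal (rexp (-(m / 4))) := by
  have := fun i : Fin n => isProbabilityMeasure_uniformOn_ne hn i
  refine netLaw_le_of_conditional hκ
    {p | A p.1 ∧ (({i | p.2 i ∈ G p.1 i} : Set (Fin n)).ncard : ℝ) ≤ m / 4} fun y => ?_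
  by_cases hy : A y
  · simp only [Set.mem_ofPred_eq, hy, true_and]
    refine measure_pi_le_quarter _ (G y) (fun i => (Set.toFinite _).measurableSet) hm ?_
    simp_rw [uniformOn_ne_real]
    have hn1 : (0 : ℝ) < n - 1 := by
      have : (2 : ℝ) ≤ n := by exact_mod_cast hn
      linarith
    rw [← Finset.sum_div, le_div_iff₀ hn1]
    refine le_trans ?_ (hG y hy)
    gcongr
    linarith
  · simp [hy]

/-! ### Areas -/

theorem volume_reProdIm_eq (s t : Set ℝ) : (volume : Measure ℂ) (s ×ℂ t) = volume s * volume t := by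
  have h := Complex.volume_preserving_equiv_real_prod.measure_preimage_equiv (s ×ˢ t)
  have h2 : Complex.measurableEquivRealProd ⁻¹' (s ×ˢ t) = s ×ℂ t := by
    ext z; simp [Complex.mem_reProdIm]
  rw [h2] at h
  rw [h, Measure.volume_eq_prod, Measure.prod_prod]

theorem measurable_cellOf (b : ℕ) : Measurable (cellOf b) := by
  unfold cellOf
  exact (Nat.measurable_floor.comp (Complex.measurable_re.const_mul _)).prodMk
    (Nat.measurable_floor.comp (Complex.measurable_im.const_mul _))

theorem mem_unitSquare {z : ℂ} : z ∈ unitSquare ↔ (0 ≤ z.re ∧ z.re < 1) ∧ 0 ≤ z.im ∧ z.im < 1 := by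
  simp [unitSquare, Complex.mem_reProdIm]

theorem cellOf_lt {b : ℕ} (hb : 1 ≤ b) {z : ℂ} (hz : z ∈ unitSquare) :
    (cellOf b z).1 < b ∧ (cellOf b z).2 < b := by
  obtain ⟨⟨h1, h2⟩, h3, h4⟩ := mem_unitSquare.mp hz
  have hb' : (0 : ℝ) < b := by exact_mod_cast hb
  simp only [cellOf]
  rw [Nat.floor_lt (by positivity), Nat.floor_lt (by positivity)]
  constructor <;> nlinarith

theorem le_of_cellOf {b : ℕ} {z : ℂ} (hz : z ∈ unitSquare) :
    ((cellOf b z).1 : ℝ) ≤ b * z.re ∧ b * z.re < (cellOf b z).1 + 1 ∧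
      ((cellOf b z).2 : ℝ) ≤ b * z.im ∧ b * z.im < (cellOf b z).2 + 1 := by
  obtain ⟨⟨h1, h2⟩, h3, h4⟩ := mem_unitSquare.mp hz
  exact ⟨Nat.floor_le (by positivity), Nat.lt_floor_add_one _, Nat.floor_le (by positivity),
    Nat.lt_floor_add_one _⟩

theorem cellOf_fiber {m : ℕ} (hm : 1 ≤ m) {q : ℕ × ℕ} (h1 : q.1 < m) (h2 : q.2 < m) :
    cellOf m ⁻¹' {q} ∩ unitSquare =
      Set.Ico ((q.1 : ℝ) / m) ((q.1 + 1) / m) ×ℂ Set.Ico ((q.2 : ℝ) / m) ((q.2 + 1) / m) := by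
  have hm' : (0 : ℝ) < m := by exact_mod_cast hm
  have h1' : (q.1 : ℝ) + 1 ≤ m := by exact_mod_cast h1
  have h2' : (q.2 : ℝ) + 1 ≤ m := by exact_mod_cast h2
  ext z
  simp only [Set.mem_inter_iff, Set.mem_preimage, Set.mem_singleton_iff, Complex.mem_reProdIm,
    Set.mem_Ico, div_le_iff₀ hm', lt_div_iff₀ hm', mem_unitSquare]
  constructor
  · rintro ⟨rfl, hz⟩
    obtain ⟨a1, a2, a3, a4⟩ := le_of_cellOf (b := m) (mem_unitSquare.mpr hz)
    refine ⟨⟨?_, ?_⟩, ?_, ?_⟩ <;> linarith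
  · rintro ⟨⟨a1, a2⟩, a3, a4⟩
    have b1 : 0 ≤ z.re := by
      have : (0 : ℝ) ≤ q.1 := by positivity
      by_contra h; nlinarith
    have b2 : 0 ≤ z.im := by
      have : (0 : ℝ) ≤ q.2 := by positivity
      by_contra h; nlinarith
    refine ⟨?_, ⟨b1, ?_⟩, b2, ?_⟩
    · ext
      · exact (Nat.floor_eq_iff (by positivity)).mpr ⟨by linarith, by linarith⟩
      · exact (Nat.floor_eq_iff (by positivity)).mpr ⟨by linarith, by linarith⟩
    · nlinarith
    · nlinarith

theorem restrict_unitSquare_cells {m : ℕ} (hm : 1 ≤ m) (S : Finset (ℕ × ℕ))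
    (hS : ∀ q ∈ S, q.1 < m ∧ q.2 < m) :
    ((volume : Measure ℂ).restrict unitSquare).real {z | cellOf m z ∈ S} = S.card / (m : ℝ) ^ 2 := by
  have hm' : (0 : ℝ) < m := by exact_mod_cast hm
  have h : {z | cellOf m z ∈ S} = ⋃ q ∈ S, cellOf m ⁻¹' {q} := by ext; simp
  have hmeas : ∀ q ∈ S, MeasurableSet (cellOf m ⁻¹' {q}) := fun q _ =>
    measurable_cellOf m (measurableSet_singleton q)
  rw [h, measureReal_biUnion_finset _ hmeas]
  · have : ∀ q ∈ S, ((volume : Measure ℂ).restrict unitSquare).real (cellOf m ⁻¹' {q}) =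
        1 / (m : ℝ) ^ 2 := by
      intro q hq
      have hlen : ∀ a : ℝ, (a + 1) / m - a / m = 1 / m := fun a => by ring
      rw [measureReal_def, Measure.restrict_apply (hmeas q hq), cellOf_fiber hm (hS q hq).1
        (hS q hq).2, volume_reProdIm_eq, Real.volume_Ico, Real.volume_Ico, hlen, hlen,
        ENNReal.toReal_mul, ENNReal.toReal_ofReal (by positivity)]
      field_simp
    rw [Finset.sum_congr rfl this]
    simp [div_eq_mul_inv]
  · intro p _ q _ hpq
    exact Disjoint.preimage _ (by simpa using hpq)

theorem restrict_unitSquare_disc (w : ℂ) {ρ : ℝ} (hρ : 0 ≤ ρ) :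
    ((volume : Measure ℂ).restrict unitSquare).real {z | dist w z ≤ ρ} ≤ π * ρ ^ 2 := by
  have h : {z | dist w z ≤ ρ} = Metric.closedBall w ρ := by
    ext z; simp [dist_comm]
  rw [h, measureReal_def]
  refine (ENNReal.toReal_mono ?_ (Measure.restrict_apply_le _ _)).trans ?_
  · rw [Complex.volume_closedBall]; exact (ENNReal.mul_lt_top (by simp) (by simp)).ne
  · rw [Complex.volume_closedBall]
    simp [ENNReal.toReal_ofReal hρ, mul_comm]

/-- Polar coordinates: the wedge lies over a rectangle in radius and angle, and the density `x`
integrates to `R ^ 2 / 2` along the radius. -/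
theorem volume_wedge_le {R α β : ℝ} (hR : 0 ≤ R) :
    (volume : Measure ℂ) {z | ‖z‖ ≤ R ∧ α < z.arg ∧ z.arg ≤ β} ≤
      ENNReal.ofReal (R ^ 2 / 2 * (β - α)) := by
  set W : Set ℂ := {z | ‖z‖ ≤ R ∧ α < z.arg ∧ z.arg ≤ β} with hW
  have hWm : MeasurableSet W :=
    (measurableSet_le measurable_norm measurable_const).inter
      ((measurableSet_lt measurable_const Complex.measurable_arg).inter
        (measurableSet_le Complex.measurable_arg measurable_const))
  rw [← lintegral_indicator_one hWm, ← Complex.lintegral_comp_polarCoord_symm]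
  have hle : ∀ p ∈ polarCoord.target, ENNReal.ofReal p.1 • W.indicator 1 (Complex.polarCoord.symm p)
      ≤ ((Set.Ioc 0 R).indicator (fun x : ℝ => ENNReal.ofReal x) p.1) *
        (Set.Ioc α β).indicator (fun _ => (1 : ENNReal)) p.2 := by
    rintro ⟨x, t⟩ hp
    simp only [polarCoord_target, Set.mem_prod, Set.mem_Ioi, Set.mem_Ioo] at hp
    obtain ⟨hx, ht1, ht2⟩ := hp
    by_cases hmem : Complex.polarCoord.symm (x, t) ∈ W
    · have harg : (Complex.polarCoord.symm (x, t)).arg = t := by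
        rw [Complex.polarCoord_symm_apply]
        simpa using Complex.arg_mul_cos_add_sin_mul_I hx ⟨ht1, ht2.le⟩
      have hnorm : ‖Complex.polarCoord.symm (x, t)‖ = x := by
        rw [Complex.norm_polarCoord_symm, abs_of_pos hx]
      have h1 : x ∈ Set.Ioc 0 R := ⟨hx, hnorm ▸ hmem.1⟩
      have h2 : t ∈ Set.Ioc α β := ⟨by rw [← harg]; exact hmem.2.1, by rw [← harg]; exact hmem.2.2⟩
      rw [Set.indicator_of_mem hmem, Set.indicator_of_mem h1, Set.indicator_of_mem h2]
      simp
    · rw [Set.indicator_of_notMem hmem]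
      simp
  calc _ ≤ ∫⁻ p in polarCoord.target, ((Set.Ioc 0 R).indicator (fun x : ℝ => ENNReal.ofReal x) p.1) *
        (Set.Ioc α β).indicator (fun _ => (1 : ENNReal)) p.2 :=
        setLIntegral_mono' polarCoord.open_target.measurableSet hle
    _ ≤ ∫⁻ p : ℝ × ℝ, ((Set.Ioc 0 R).indicator (fun x : ℝ => ENNReal.ofReal x) p.1) *
        (Set.Ioc α β).indicator (fun _ => (1 : ENNReal)) p.2 := setLIntegral_le_lintegral _ _
    _ = (∫⁻ x in Set.Ioc 0 R, ENNReal.ofReal x) * volume (Set.Ioc α β) := by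
        rw [Measure.volume_eq_prod, lintegral_prod_mul, lintegral_indicator measurableSet_Ioc]
        · congr 1
          exact lintegral_indicator_one measurableSet_Ioc
        · exact (ENNReal.measurable_ofReal.indicator measurableSet_Ioc).aemeasurable
        · exact (measurable_const.indicator measurableSet_Ioc).aemeasurable
    _ = ENNReal.ofReal (R ^ 2 / 2) * ENNReal.ofReal (β - α) := by
        rw [Real.volume_Ioc, ← ofReal_integral_eq_lintegral_ofReal]
        · rw [← intervalIntegral.integral_of_le hR, integral_id]; simp
        · exact (continuous_id.integrableOn_Icc (a := 0) (b := R)).mono_set Set.Ioc_subset_Icc_self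
        · filter_upwards [ae_restrict_mem measurableSet_Ioc] with x hx using hx.1.le
    _ = _ := by rw [← ENNReal.ofReal_mul (by positivity)]

/-! ### Sectors -/

/-- The index of the sector of angular width `π / P` that contains the direction of `z`. -/
noncomputable def sectorIndex (P : ℕ) (z : ℂ) : ℕ := ⌊(π - z.arg) * P / π⌋₊

theorem measurable_sectorIndex (P : ℕ) : Measurable (sectorIndex P) :=
  Nat.measurable_floor.comp
    (((measurable_const.sub Complex.measurable_arg).mul_const _).div_const _)

/-- Sectors are counted clockwise from `π`. As `arg` takes its values in `(-π, π]`, the floored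
quantity is nonnegative and strictly less than `2 * P`. -/
theorem sectorIndex_bounds {P : ℕ} (hP : 1 ≤ P) (z : ℂ) :
    sectorIndex P z < 2 * P ∧ π - (sectorIndex P z + 1) * (π / P) < z.arg ∧
      z.arg ≤ π - sectorIndex P z * (π / P) := by
  have hP' : (0 : ℝ) < P := by exact_mod_cast hP
  have h0 : 0 ≤ (π - z.arg) * P / π := by
    have := Complex.arg_le_pi z
    have := pi_pos
    have : 0 ≤ π - z.arg := by linarith
    positivity
  have h1 := Nat.floor_le h0
  have h2 := Nat.lt_floor_add_one ((π - z.arg) * P / π)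
  refine ⟨?_, ?_, ?_⟩
  · rw [sectorIndex, Nat.floor_lt h0, div_lt_iff₀ pi_pos]
    have := Complex.neg_pi_lt_arg z
    push_cast
    nlinarith
  · rw [div_lt_iff₀ pi_pos] at h2
    simp only [sectorIndex]
    have : π - z.arg < ((⌊(π - z.arg) * P / π⌋₊ : ℝ) + 1) * (π / P) := by
      rw [mul_div_assoc', lt_div_iff₀ hP']; exact h2
    linarith
  · rw [le_div_iff₀ pi_pos] at h1
    simp only [sectorIndex]
    have : (⌊(π - z.arg) * P / π⌋₊ : ℝ) * (π / P) ≤ π - z.arg := by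
      rw [mul_div_assoc', div_le_iff₀ hP']; exact h1
    linarith

theorem restrict_unitSquare_sector {b P : ℕ} (hb : 1 ≤ b) (hP : 1 ≤ P) (q : ℕ × ℕ) (k : ℕ) :
    ((volume : Measure ℂ).restrict unitSquare).real
      {z | cellOf b z = q ∧ sectorIndex P (z - station b q) = k} ≤ 1 / ((b : ℝ) ^ 2 * P) := by
  have hb' : (0 : ℝ) < b := by exact_mod_cast hb
  have hP' : (0 : ℝ) < P := by exact_mod_cast hP
  -- Half the diagonal of a cell: the disc of this radius around the station contains the cell. The
  -- wedge then has area `π / (4 * b ^ 2 * P)`, and `π / 4 ≤ 1`.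
  set R : ℝ := √(1 / (2 * (b : ℝ) ^ 2)) with hR
  set W : Set ℂ := {z | ‖z‖ ≤ R ∧ π - (k + 1) * (π / P) < z.arg ∧ z.arg ≤ π - k * (π / P)} with hW
  have hsub : {z | cellOf b z = q ∧ sectorIndex P (z - station b q) = k} ∩ unitSquare ⊆
      (fun z => z - station b q) ⁻¹' W := by
    rintro z ⟨⟨rfl, rfl⟩, hz⟩
    obtain ⟨a1, a2, a3, a4⟩ := le_of_cellOf (b := b) hz
    refine ⟨?_, (sectorIndex_bounds hP _).2.1, (sectorIndex_bounds hP _).2.2⟩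
    rw [hR]
    refine Real.le_sqrt_of_sq_le ?_
    rw [← Complex.normSq_eq_norm_sq, Complex.normSq_apply]
    simp only [station, Complex.sub_re, Complex.sub_im]
    have hkey : ∀ t c : ℝ, c ≤ b * t → b * t < c + 1 →
        (t - (c + 1 / 2) / b) * (t - (c + 1 / 2) / b) ≤ 1 / (4 * (b : ℝ) ^ 2) := by
      intro t c h1 h2
      have e : t - (c + 1 / 2) / b = (b * t - c - 1 / 2) / b := by field_simp; ring
      rw [e, div_mul_div_comm, div_le_div_iff₀ (by positivity) (by positivity)]
      have : (b * t - c - 1 / 2) * (b * t - c - 1 / 2) ≤ 1 / 4 := by nlinarith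
      nlinarith [mul_pos hb' hb']
    have := hkey _ _ a1 a2
    have := hkey _ _ a3 a4
    have e : 1 / (2 * (b : ℝ) ^ 2) = 1 / (4 * (b : ℝ) ^ 2) + 1 / (4 * (b : ℝ) ^ 2) := by
      field_simp; norm_num
    rw [e]
    linarith
  have hlen : π - k * (π / P) - (π - (k + 1) * (π / P)) = π / P := by ring
  have hvol := volume_wedge_le (R := R) (α := π - (k + 1) * (π / P)) (β := π - k * (π / P))
    (by positivity)
  rw [hlen] at hvol
  have hm : MeasurableSet {z | cellOf b z = q ∧ sectorIndex P (z - station b q) = k} :=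
    (measurable_cellOf b (measurableSet_singleton q)).inter
      ((measurable_sectorIndex P).comp (measurable_id.sub_const _) (measurableSet_singleton k))
  rw [measureReal_def, Measure.restrict_apply hm]
  refine ENNReal.toReal_le_of_le_ofReal (by positivity) ((measure_mono hsub).trans ?_)
  simp_rw [sub_eq_add_neg]
  rw [measure_preimage_add_right]
  refine hvol.trans (ENNReal.ofReal_le_ofReal ?_)
  rw [hR, Real.sq_sqrt (by positivity)]
  have : 1 / (2 * (b : ℝ) ^ 2) / 2 * (π / P) = (π / 4) * (1 / ((b : ℝ) ^ 2 * P)) := by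
    field_simp; norm_num
  rw [this]
  refine mul_le_of_le_one_left (by positivity) ?_
  linarith [pi_le_four]

/-! ### Beams -/

/-- The direction of the bisector of a sector. -/
noncomputable def sectorCentre (P k : ℕ) : Real.Angle := ((π - (k + 1 / 2) * (π / P) : ℝ) : Real.Angle)

/-- For `P = ⌊2π/θ⌋`, `(P + 1) * θ > 2π` and `θ ≤ π` force `P * θ > π`. Hence a sector of width `π /
P` is narrower than a beam, while `P` beams still fit side by side on the circle. -/
theorem floor_beams {θ : ℝ} (h0 : 0 < θ) (h1 : θ ≤ π) :
    2 ≤ ⌊2 * π / θ⌋₊ ∧ ⌊2 * π / θ⌋₊ * θ ≤ 2 * π ∧ π / ⌊2 * π / θ⌋₊ < θ := by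
  have h2 : 2 ≤ ⌊2 * π / θ⌋₊ := by
    rw [Nat.le_floor_iff (by positivity), le_div_iff₀ h0]
    push_cast
    linarith
  have h2' : (2 : ℝ) ≤ ⌊2 * π / θ⌋₊ := by exact_mod_cast h2
  refine ⟨h2, ?_, ?_⟩
  · rw [← le_div_iff₀ h0]
    exact Nat.floor_le (by positivity)
  · have h3 := Nat.lt_floor_add_one (2 * π / θ)
    rw [div_lt_iff₀ h0] at h3
    rw [div_lt_iff₀ (by linarith)]
    nlinarith

theorem mem_beam_self {θ : ℝ} (h : 0 < θ) (β : Real.Angle) : β ∈ beam θ β := by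
  simp [beam, h]

theorem arg_mem_beam {θ : ℝ} {P : ℕ} (hP : 1 ≤ P) (h : π / P < θ) (z : ℂ) :
    (z.arg : Real.Angle) ∈ beam θ (sectorCentre P (sectorIndex P z)) := by
  have hP' : (1 : ℝ) ≤ P := by exact_mod_cast hP
  obtain ⟨-, h1, h2⟩ := sectorIndex_bounds hP z
  have hle : π / P ≤ π := div_le_self pi_pos.le hP'
  have h0 : 0 < π / P := by positivity
  rw [beam, Set.mem_ofPred_eq, sectorCentre, ← Real.Angle.coe_sub,
    Real.Angle.toReal_coe_eq_self_iff.mpr ⟨by linarith, by linarith⟩, abs_lt]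
  constructor <;> linarith

/-- For equal parities the bisectors differ by a multiple of `2π / P`, nonzero modulo `2π`, hence by
at least `θ`; a common direction of the two beams would put them at a distance less than `θ`. -/
theorem disjoint_beam_sectorCentre {θ : ℝ} {P : ℕ} (hP : 1 ≤ P) (h : P * θ ≤ 2 * π) {k l : ℕ}
    (hk : k < 2 * P) (hl : l < 2 * P) (hkl : k ≠ l) (hpar : k % 2 = l % 2) :
    Disjoint (beam θ (sectorCentre P k)) (beam θ (sectorCentre P l)) := by
  have hP' : (0 : ℝ) < P := by exact_mod_cast hP
  rw [Set.disjoint_left]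
  intro γ h1 h2
  rw [beam, Set.mem_ofPred_eq, abs_lt] at h1 h2
  set a := (γ - sectorCentre P k).toReal with ha
  set b := (γ - sectorCentre P l).toReal with hb
  have hab : ((a - b : ℝ) : Real.Angle) = (((k : ℝ) - l) * (π / P) : ℝ) := by
    rw [Real.Angle.coe_sub, ha, hb, Real.Angle.coe_toReal, Real.Angle.coe_toReal, sectorCentre,
      sectorCentre, sub_sub_sub_cancel_left, ← Real.Angle.coe_sub]
    congr 1
    ring
  obtain ⟨z, hz⟩ := Real.Angle.angle_eq_iff_two_pi_dvd_sub.mp hab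
  obtain ⟨j, hj⟩ : ∃ j : ℤ, (k : ℤ) - l = 2 * j := by
    refine ⟨((k : ℤ) - l) / 2, ?_⟩
    omega
  have hj0 : j + P * z ≠ 0 := by
    intro h0
    have hj1 : j ≠ 0 := by omega
    have hj2 : |j| < P := by rw [abs_lt]; constructor <;> omega
    have hdvd : (P : ℤ) ∣ j := ⟨-z, by linarith⟩
    exact hj1 (Int.eq_zero_of_abs_lt_dvd hdvd hj2)
  have hjr : ((k : ℝ) - l) = 2 * j := by exact_mod_cast hj
  have hval : a - b = (2 * π / P) * ((j + P * z : ℤ) : ℝ) := by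
    have : a - b = 2 * π * z + ((k : ℝ) - l) * (π / P) := by linarith
    rw [this, hjr]
    push_cast
    field_simp
    ring
  have habs : (1 : ℝ) ≤ |((j + P * z : ℤ) : ℝ)| := by
    exact_mod_cast Int.one_le_abs hj0
  have hθ : θ ≤ 2 * π / P := by rw [le_div_iff₀ hP']; linarith
  have hlt : |a - b| < θ := by rw [abs_lt]; constructor <;> linarith
  rw [hval, abs_mul, abs_of_pos (by positivity)] at hlt
  have : 0 < 2 * π / P := by positivity
  nlinarith

theorem norm_coe_addCircle_eq_abs_toReal (t : ℝ) :
    ‖((t : ℝ) : AddCircle (2 * π))‖ = |((t : ℝ) : Real.Angle).toReal| := by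
  have h : (((t : Real.Angle).toReal : ℝ) : AddCircle (2 * π)) = (t : AddCircle (2 * π)) :=
    Real.Angle.coe_toReal (t : Real.Angle)
  have h2 := Real.Angle.abs_toReal_le_pi (t : Real.Angle)
  calc ‖((t : ℝ) : AddCircle (2 * π))‖ = ‖(((t : Real.Angle).toReal : ℝ) : AddCircle (2 * π))‖ := by
        rw [h]
    _ = _ := by
        rw [AddCircle.norm_coe_eq_abs_iff _ (by positivity), abs_of_pos two_pi_pos]
        linarith

/-- Packing on a circle of length `2π`: for each `ρ < θ` the beams contain disjoint closed arcs of
length `ρ`, so their number times `ρ` is at most `2π`; then `ρ` tends to `θ`. -/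
theorem card_disjoint_beams_le {θ : ℝ} (h0 : 0 < θ) (h1 : θ ≤ π) (B : Finset Real.Angle)
    (hB : ∀ β ∈ B, ∀ γ ∈ B, β ≠ γ → Disjoint (beam θ β) (beam θ γ)) :
    B.card ≤ ⌊2 * π / θ⌋₊ := by
  have : Fact (0 < 2 * π) := ⟨two_pi_pos⟩
  rw [Nat.le_floor_iff (by positivity), le_div_iff₀ h0]
  have key : ∀ ρ : ℝ, 0 < ρ → ρ < θ → B.card * ρ ≤ 2 * π := by
    intro ρ hρ hρθ
    let D : Real.Angle → Set (AddCircle (2 * π)) :=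
      fun β => Metric.closedBall ((β.toReal : ℝ) : AddCircle (2 * π)) (ρ / 2)
    have hsub : ∀ (β : Real.Angle) (t : ℝ), (t : AddCircle (2 * π)) ∈ D β →
        (t : Real.Angle) ∈ beam θ β := by
      intro β t hx
      have hx' : ‖((t - β.toReal : ℝ) : AddCircle (2 * π))‖ ≤ ρ / 2 := by
        rw [AddCircle.coe_sub, ← dist_eq_norm]; exact hx
      rw [norm_coe_addCircle_eq_abs_toReal, Real.Angle.coe_sub, Real.Angle.coe_toReal] at hx'
      rw [beam, Set.mem_ofPred_eq]
      linarith
    have hvol : ∀ β, volume (D β) = ENNReal.ofReal ρ := by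
      intro β
      simp only [D]
      rw [AddCircle.volume_closedBall, min_eq_right (by linarith)]
      congr 1; ring
    have hdis : (B : Set Real.Angle).PairwiseDisjoint D := by
      intro β hβ γ hγ hne
      refine Set.disjoint_left.mpr fun x hx hx' => ?_
      obtain ⟨t, rfl⟩ := QuotientAddGroup.mk_surjective x
      exact Set.disjoint_left.mp (hB β hβ γ hγ hne) (hsub β t hx) (hsub γ t hx')
    have hle := measure_mono (μ := (volume : Measure (AddCircle (2 * π))))
      (Set.subset_univ (⋃ β ∈ B, D β))
    rw [measure_biUnion_finset hdis (fun β _ => measurableSet_closedBall)] at hle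
    simp only [hvol, Finset.sum_const, nsmul_eq_mul, AddCircle.measure_univ] at hle
    rw [← ENNReal.ofReal_natCast, ← ENNReal.ofReal_mul (by positivity),
      ENNReal.ofReal_le_ofReal_iff (by positivity)] at hle
    exact hle
  refine le_of_tendsto (f := fun ρ : ℝ => B.card * ρ) (x := 𝓝[<] θ)
    ((continuous_const.mul continuous_id).continuousAt.tendsto.mono_left nhdsWithin_le_nhds) ?_
  filter_upwards [Ioo_mem_nhdsLT h0] with ρ hρ using key ρ hρ.1 hρ.2

/-- Distinct directions in `L` have disjoint beams, and one direction carries at most `C` channels.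
-/
theorem card_nonconflicting_le {θ : ℝ} {C : ℕ} (h0 : 0 < θ) (h1 : θ ≤ π)
    (L : Finset (Real.Angle × Fin C)) (hL : ∀ p ∈ L, ∀ q ∈ L, p ≠ q → NoConflict θ p q) :
    L.card ≤ ⌊2 * π / θ⌋₊ * C := by
  classical
  have hB : (L.image Prod.fst).card ≤ ⌊2 * π / θ⌋₊ := by
    refine card_disjoint_beams_le h0 h1 _ ?_
    intro β hβ γ hγ hne
    obtain ⟨p, hp, rfl⟩ := Finset.mem_image.mp hβ
    obtain ⟨q, hq, rfl⟩ := Finset.mem_image.mp hγ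
    rcases hL p hp q hq (fun h => hne (by rw [h])) with h | h
    · exact absurd h.1 hne
    · exact h
  calc L.card ≤ (L.image Prod.fst ×ˢ (Finset.univ : Finset (Fin C))).card :=
        Finset.card_le_card fun p hp =>
          Finset.mem_product.mpr ⟨Finset.mem_image_of_mem _ hp, Finset.mem_univ _⟩
    _ ≤ _ := by
        rw [Finset.card_product, Finset.card_univ, Fintype.card_fin]
        exact Nat.mul_le_mul_right _ hB

/-- The maximum is attained by using all channels on the beams aimed at the `P` sectors of even
index. -/
theorem isGreatest_simultaneous {θ : ℝ} {C : ℕ} (h0 : 0 < θ) (h1 : θ ≤ π) :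
    IsGreatest (simultaneous θ C) (⌊2 * π / θ⌋₊ * C) := by
  classical
  obtain ⟨hP2, hPθ, hπP⟩ := floor_beams h0 h1
  set P := ⌊2 * π / θ⌋₊ with hP
  have hdis : ∀ j < P, ∀ l < P, j ≠ l →
      Disjoint (beam θ (sectorCentre P (2 * j))) (beam θ (sectorCentre P (2 * l))) :=
    fun j hj l hl hne => disjoint_beam_sectorCentre (by omega) hPθ (by omega) (by omega) (by omega)
      (by omega)
  refine ⟨⟨(Finset.range P).image (fun j => sectorCentre P (2 * j)) ×ˢ Finset.univ, ?_, ?_⟩, ?_⟩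
  · rintro ⟨β, c⟩ hp ⟨γ, d⟩ hq hne
    simp only [Finset.mem_product, Finset.mem_image, Finset.mem_range, Finset.mem_univ,
      and_true] at hp hq
    obtain ⟨j, hj, rfl⟩ := hp
    obtain ⟨l, hl, rfl⟩ := hq
    by_cases hjl : j = l
    · subst hjl
      exact Or.inl ⟨rfl, fun h => hne (by rw [show c = d from h])⟩
    · exact Or.inr (hdis j hj l hl hjl)
  · rw [Finset.card_product, Finset.card_univ, Fintype.card_fin, Finset.card_image_of_injOn,
      Finset.card_range]
    intro j hj l hl hjl
    simp only [Finset.coe_range, Set.mem_Iio] at hj hl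
    by_contra hne
    have hd := hdis j hj l hl hne
    simp only at hjl
    rw [hjl] at hd
    exact (Set.disjoint_left.mp hd) (mem_beam_self h0 _) (mem_beam_self h0 _)
  · rintro k ⟨L, hL, rfl⟩
    exact card_nonconflicting_le h0 h1 L hL

/-! ### TDMA rounds -/

/-- Wrap-around rule: the flows are ranked so that those of one node are consecutive, and the rank
is split into its residue modulo `T` (the slot) and its quotient by `T` (the channel). At most `T`
consecutive ranks have distinct residues, so a node is never used twice in a slot. -/
theorem exists_slots {n : ℕ} (v : Fin n → Fin n) (F : Finset (Fin n)) {C T : ℕ}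
    (hF : F.card ≤ C * T) (hv : ∀ j, (F.filter fun i => v i = j).card ≤ T) :
    ∃ slot chan : Fin n → ℕ, (∀ i ∈ F, slot i < T ∧ chan i < C) ∧
      ∀ i ∈ F, ∀ j ∈ F, i ≠ j → slot i = slot j → v i ≠ v j ∧ chan i ≠ chan j := by
  let key : Fin n → Fin n ×ₗ Fin n := fun i => toLex (v i, i)
  have hkey : Function.Injective key := fun i j h => congrArg (fun p => (ofLex p).2) h
  let rk : Fin n → ℕ := fun i => (F.filter fun j => key j < key i).card
  have hlt : ∀ i ∈ F, rk i < C * T := fun i hi =>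
    (Finset.card_lt_card (Finset.filter_ssubset (p := fun j => key j < key i) |>.mpr ⟨i, hi, lt_irrefl _⟩)).trans_le hF
  have hmono : ∀ i ∈ F, ∀ j, key i < key j → rk i < rk j := by
    intro i hi j hij
    refine Finset.card_lt_card (Finset.ssubset_iff_of_subset ?_ |>.mpr ⟨i, ?_, ?_⟩)
    · intro l hl
      rw [Finset.mem_filter] at hl ⊢
      exact ⟨hl.1, hl.2.trans hij⟩
    · exact Finset.mem_filter.mpr ⟨hi, hij⟩
    · simp
  have hgap : ∀ i ∈ F, ∀ j ∈ F, key i < key j → v i = v j → rk j < rk i + T := by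
    intro i hi j hj hij hvij
    have hsub : (F.filter fun l => key l < key j) ⊆
        (F.filter fun l => key l < key i) ∪ ((F.filter fun l => v l = v j).erase j) := by
      intro l hl
      rw [Finset.mem_filter] at hl
      rw [Finset.mem_union, Finset.mem_filter, Finset.mem_erase, Finset.mem_filter]
      by_cases h : key l < key i
      · exact Or.inl ⟨hl.1, h⟩
      · refine Or.inr ⟨fun h' => ?_, hl.1, ?_⟩
        · rw [h'] at hl; exact lt_irrefl _ hl.2
        · have h1 := Prod.Lex.toLex_le_toLex.mp (not_lt.mp h)
          have h2 := Prod.Lex.toLex_lt_toLex.mp hl.2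
          simp only at h1 h2
          refine le_antisymm ?_ ?_
          · rcases h2 with h2 | h2
            · exact h2.le
            · exact h2.1.le
          · rw [← hvij]
            rcases h1 with h1 | h1
            · exact h1.le
            · exact h1.1.le
    have hj' : j ∈ F.filter fun l => v l = v j := Finset.mem_filter.mpr ⟨hj, rfl⟩
    have h1 := (Finset.card_le_card hsub).trans (Finset.card_union_le _ _)
    rw [Finset.card_erase_of_mem hj'] at h1
    have h2 := hv (v j)
    have h3 := Finset.card_pos.mpr ⟨j, hj'⟩
    simp only [rk]
    omega
  have hmod : ∀ a b : ℕ, a < b → b < a + T → a % T ≠ b % T := by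
    intro a b hab hb h
    have h1 : T ∣ b - a := (Nat.modEq_iff_dvd' hab.le).mp h
    exact absurd (Nat.le_of_dvd (by omega) h1) (by omega)
  refine ⟨fun i => rk i % T, fun i => rk i / T, fun i hi => ⟨?_, ?_⟩, ?_⟩
  · have := hlt i hi
    refine Nat.mod_lt _ (Nat.pos_of_ne_zero fun h => ?_)
    rw [h] at this; omega
  · exact Nat.div_lt_of_lt_mul (by rw [mul_comm]; exact hlt i hi)
  · intro i hi j hj hne hs
    simp only at hs
    refine ⟨fun hvij => ?_, fun hc => ?_⟩
    · rcases lt_or_gt_of_ne (hkey.ne hne) with h | h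
      · exact hmod _ _ (hmono i hi j h) (hgap i hi j hj h hvij) hs
      · exact hmod _ _ (hmono j hj i h) (hgap j hj i hi h hvij.symm) hs.symm
    · have hrk : rk i = rk j := by
        rw [← Nat.div_add_mod (rk i) T, ← Nat.div_add_mod (rk j) T, hs]
        simp only at hc
        rw [hc]
      rcases lt_or_gt_of_ne (hkey.ne hne) with h | h
      · exact (hmono i hi j h).ne hrk
      · exact (hmono j hj i h).ne hrk.symm

/-- The even sectors are served in the first `T` slots and the odd ones in the next `T`. Within a
phase different sectors have disjoint beams, so each runs its own wrap-around schedule; flows in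
different sectors involve different nodes because the sector is determined by the node. -/
theorem roundLength_le {n : ℕ} {θ : ℝ} (h0 : 0 < θ) (h1 : θ ≤ π) {C T : ℕ} (hC : 1 ≤ C)
    (s : ℂ)    (x : Fin n → ℂ) (v : Fin n → Fin n) (F : Set (Fin n))
    (hsec : ∀ k < 2 * ⌊2 * π / θ⌋₊,
      {i | i ∈ F ∧ sectorIndex ⌊2 * π / θ⌋₊ (x (v i) - s) = k}.ncard ≤ C * T)
    (hmul : ∀ j, {i | i ∈ F ∧ v i = j}.ncard ≤ T) :
    roundLength θ C s x v F ≤ 2 * T := by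
  classical
  obtain ⟨hP2, hPθ, hπP⟩ := floor_beams h0 h1
  set P := ⌊2 * π / θ⌋₊ with hP
  let sec : Fin n → ℕ := fun i => sectorIndex P (x (v i) - s)
  have hseclt : ∀ i, sec i < 2 * P := fun i => (sectorIndex_bounds (by omega) _).1
  have hex : ∀ k : ℕ, ∃ slot chan : Fin n → ℕ,
      (∀ i, i ∈ F ∧ sec i = k → slot i < T ∧ chan i < C) ∧
      ∀ i, i ∈ F ∧ sec i = k → ∀ j, j ∈ F ∧ sec j = k → i ≠ j → slot i = slot j →
        v i ≠ v j ∧ chan i ≠ chan j := by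
    intro k
    have hk : {i | i ∈ F ∧ sec i = k}.ncard ≤ C * T := by
      by_cases hk : k < 2 * P
      · exact hsec k hk
      · have : {i | i ∈ F ∧ sec i = k} = ∅ := by
          ext i
          have := hseclt i
          simp only [Set.mem_ofPred_eq, Set.mem_empty_iff_false, iff_false]
          rintro ⟨-, h⟩
          omega
        rw [this, Set.ncard_empty]
        exact Nat.zero_le _
    obtain ⟨slot, chan, h1, h2⟩ := exists_slots v
      (Finset.univ.filter fun i => i ∈ F ∧ sec i = k) (C := C) (T := T)
      (by rwa [Set.ncard_eq_toFinset_card', Set.toFinset_ofPred] at hk) (by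
        intro j
        refine le_trans ?_ (hmul j)
        rw [Set.ncard_eq_toFinset_card', Set.toFinset_ofPred]
        refine Finset.card_le_card fun i hi => ?_
        simp only [Finset.mem_filter, Finset.mem_univ, true_and] at hi ⊢
        exact ⟨hi.1.1, hi.2⟩)
    refine ⟨slot, chan, fun i hi => h1 i (by simpa using hi), fun i hi j hj => ?_⟩
    exact h2 i (by simpa using hi) j (by simpa using hj)
  choose slot chan hlt hne using hex
  refine Nat.sInf_le ?_
  refine ⟨fun i => (sec i % 2) * T + slot (sec i) i,
    fun i => (sectorCentre P (sec i), if h : chan (sec i) i < C then ⟨chan (sec i) i, h⟩ else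
      ⟨0, hC⟩), ?_, ?_⟩
  · intro i hi
    have hh := hlt (sec i) i ⟨hi, rfl⟩
    refine ⟨?_, arg_mem_beam (by omega) hπP _⟩
    have : sec i % 2 ≤ 1 := by omega
    nlinarith
  · intro i hi j hj hij hs
    simp only at hs
    have hi' := hlt (sec i) i ⟨hi, rfl⟩
    have hj' := hlt (sec j) j ⟨hj, rfl⟩
    have hpar : sec i % 2 = sec j % 2 := by
      rcases Nat.mod_two_eq_zero_or_one (sec i) with h | h <;>
        rcases Nat.mod_two_eq_zero_or_one (sec j) with h' | h' <;> rw [h, h'] at hs ⊢ <;>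
        omega
    have hs' : slot (sec i) i = slot (sec j) j := by
      rw [hpar] at hs; omega
    by_cases hsec' : sec i = sec j
    · obtain ⟨h3, h4⟩ := hne (sec j) i ⟨hi, hsec'⟩ j ⟨hj, rfl⟩ hij (by rw [← hsec', hs', hsec'])
      refine ⟨h3, Or.inl ⟨by simp only [hsec'], ?_⟩⟩
      simp only [hi'.2, hj'.2, dite_true, ne_eq, Fin.mk.injEq]
      rw [hsec']
      exact h4
    · refine ⟨fun h => hsec' (by simp only [sec, h]), Or.inr ?_⟩
      exact disjoint_beam_sectorCentre (by omega) hPθ (hseclt i) (hseclt j) hsec' hpar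

/-- Serving flow `i` alone in slot `i` is a round. Hence the infimum in `roundLength` is attained
and is not the default value of an empty set. -/
theorem hasRound_nonempty {n : ℕ} {θ : ℝ} (h0 : 0 < θ) {C : ℕ} (hC : 1 ≤ C) (s : ℂ)
    (x : Fin n → ℂ) (v : Fin n → Fin n) (F : Set (Fin n)) :
    {T | HasRound θ C s x v F T}.Nonempty := by
  refine ⟨n, fun i => i, fun i => (((x (v i) - s).arg : Real.Angle), ⟨0, hC⟩), fun i _ =>
    ⟨i.2, mem_beam_self h0 _⟩, fun i _ j _ hne h => absurd (Fin.ext h) hne⟩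

theorem ncard_le_mul_roundLength {n : ℕ} {θ : ℝ} (h0 : 0 < θ) (h1 : θ ≤ π) {C : ℕ} (hC : 1 ≤ C)
    (s : ℂ) (x : Fin n → ℂ) (v : Fin n → Fin n) (F : Set (Fin n)) :
    F.ncard ≤ (⌊2 * π / θ⌋₊ * C) * roundLength θ C s x v F := by
  classical
  obtain ⟨slot, link, hcov, hnc⟩ : HasRound θ C s x v F (roundLength θ C s x v F) :=
    Nat.sInf_mem (hasRound_nonempty h0 hC s x v F)
  rw [Set.ncard_eq_toFinset_card']
  have hcard := Finset.card_le_mul_card_image_of_maps_to (s := F.toFinset)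
    (t := Finset.range (roundLength θ C s x v F)) (f := slot)
    (fun i hi => Finset.mem_range.mpr (hcov i (Set.mem_toFinset.mp hi)).1) (⌊2 * π / θ⌋₊ * C) (by
      intro t _
      -- A transmission conflicts with itself, since its beam is nonempty; so flows of one slot use
      -- different links and can be counted by them.
      have hinj : Set.InjOn link {i | i ∈ F ∧ slot i = t} := by
        rintro i ⟨hi, hit⟩ j ⟨hj, hjt⟩ hl
        by_contra hne
        rcases (hnc i hi j hj hne (hit.trans hjt.symm)).2 with h | h
        · exact h.2 (by rw [hl])
        · rw [hl] at h
          exact Set.disjoint_left.mp h (mem_beam_self h0 _) (mem_beam_self h0 _)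
      rw [← Finset.card_image_of_injOn (f := link)]
      · refine card_nonconflicting_le h0 h1 _ ?_
        intro p hp q hq hpq
        simp only [Finset.mem_image, Finset.mem_filter, Set.mem_toFinset] at hp hq
        obtain ⟨i, ⟨hi, hit⟩, rfl⟩ := hp
        obtain ⟨j, ⟨hj, hjt⟩, rfl⟩ := hq
        exact (hnc i hi j hj (fun h => hpq (by rw [h])) (hit.trans hjt.symm)).2
      · intro i hi j hj hl
        simp only [Finset.coe_filter, Set.mem_toFinset, Set.mem_ofPred_eq] at hi hj
        exact hinj hi hj hl)
  rwa [Finset.card_range] at hcard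

/-! ### Hop distances -/

theorem dist_le_of_walk {n : ℕ} {r : ℝ} {x : Fin n → ℂ} {i j : Fin n}
    (w : (hopGraph r x).Walk i j) : dist (x i) (x j) ≤ w.length * r := by
  induction w with
  | nil => simp
  | cons h w ih =>
    refine (dist_triangle _ _ _).trans ((add_le_add h.2 ih).trans_eq ?_)
    rw [SimpleGraph.Walk.length_cons]
    push_cast
    ring

/-- Finiteness of `edist` gives reachability, so that `dist` is the length of an actual route and
not the value `0` of a disconnected pair. -/
theorem dist_le_of_edist_le {n : ℕ} {r : ℝ} (hr : 0 ≤ r) {x : Fin n → ℂ} {i j : Fin n} {t : ℕ}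
    (h : (hopGraph r x).edist i j ≤ (t : ℕ∞)) :
    dist (x i) (x j) ≤ t * r ∧ (hopGraph r x).dist i j ≤ t ∧
      dist (x i) (x j) ≤ (hopGraph r x).dist i j * r := by
  have hne : (hopGraph r x).edist i j ≠ ⊤ := ne_top_of_le_ne_top (ENat.natCast_ne_top t) h
  have hreach : (hopGraph r x).Reachable i j := SimpleGraph.edist_ne_top_iff_reachable.mp hne
  have hle : (hopGraph r x).dist i j ≤ t := ENat.toNat_le_of_le_natCast h
  obtain ⟨w, hw⟩ := hreach.exists_walk_length_eq_dist
  have h1 := dist_le_of_walk w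
  rw [hw] at h1
  refine ⟨h1.trans ?_, hle, h1⟩
  gcongr

theorem edist_le_one {n : ℕ} {r : ℝ} {x : Fin n → ℂ} {i j : Fin n} (h : dist (x i) (x j) ≤ r) :
    (hopGraph r x).edist i j ≤ 1 := by
  by_cases hij : i = j
  · subst hij; simp
  · have hadj : (hopGraph r x).Adj i j := ⟨hij, h⟩
    exact (SimpleGraph.edist_eq_one_iff_adj.mpr hadj).le

/-! ### Cells -/

theorem dist_le_of_cellOf {m : ℕ} (hm : 1 ≤ m) {z w : ℂ} (hz : z ∈ unitSquare)
    (hw : w ∈ unitSquare) {a b : ℝ}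
    (h1 : |((cellOf m z).1 : ℝ) - (cellOf m w).1| ≤ a)
    (h2 : |((cellOf m z).2 : ℝ) - (cellOf m w).2| ≤ b) :
    dist z w ≤ (a + b + 2) / m := by
  have hm' : (0 : ℝ) < m := by exact_mod_cast hm
  obtain ⟨a1, a2, a3, a4⟩ := le_of_cellOf (b := m) hz
  obtain ⟨b1, b2, b3, b4⟩ := le_of_cellOf (b := m) hw
  rw [abs_le] at h1 h2
  rw [dist_eq_norm]
  refine (Complex.norm_le_abs_re_add_abs_im _).trans ?_
  rw [Complex.sub_re, Complex.sub_im]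
  have e1 : |z.re - w.re| ≤ (a + 1) / m := by
    rw [le_div_iff₀ hm', ← abs_of_pos hm', ← abs_mul, abs_le]
    constructor <;> nlinarith
  have e2 : |z.im - w.im| ≤ (b + 1) / m := by
    rw [le_div_iff₀ hm', ← abs_of_pos hm', ← abs_mul, abs_le]
    constructor <;> nlinarith
  calc _ ≤ (a + 1) / m + (b + 1) / m := add_le_add e1 e2
    _ = _ := by ring

theorem cellOf_sub_le_of_dist {m : ℕ} {z w : ℂ} (hz : z ∈ unitSquare)
    (hw : w ∈ unitSquare) :
    |((cellOf m z).1 : ℝ) - (cellOf m w).1| ≤ m * dist z w + 1 ∧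
      |((cellOf m z).2 : ℝ) - (cellOf m w).2| ≤ m * dist z w + 1 := by
  have hm' : (0 : ℝ) ≤ m := by positivity
  obtain ⟨a1, a2, a3, a4⟩ := le_of_cellOf (b := m) hz
  obtain ⟨b1, b2, b3, b4⟩ := le_of_cellOf (b := m) hw
  have h1 := Complex.abs_re_le_norm (z - w)
  have h2 := Complex.abs_im_le_norm (z - w)
  rw [← dist_eq_norm, Complex.sub_re] at h1
  rw [← dist_eq_norm, Complex.sub_im] at h2
  rw [abs_le] at h1 h2
  constructor <;> rw [abs_le] <;> constructor <;> nlinarith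

/-- All pairs of nodes in the cells `c` and `c'` are within `t` hops. -/
def CellsWithin {n : ℕ} (m : ℕ) (r : ℝ) (x : Fin n → ℂ) (c c' : ℕ × ℕ) (t : ℕ) : Prop :=
  ∀ i j, cellOf m (x i) = c → cellOf m (x j) = c' → (hopGraph r x).edist i j ≤ (t : ℕ∞)

/-- The cells `c` and `c'` coincide or share an edge. -/
def CellsAdjacent (c c' : ℕ × ℕ) : Prop :=
  |(c.1 : ℝ) - c'.1| + |(c.2 : ℝ) - c'.2| ≤ 1

/-! ### Routes through good cells, and hubs of blocks. -/

section Percolation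

variable {n m : ℕ} {r : ℝ} {x : Fin n → ℂ} {c c' c'' : ℕ × ℕ} {s t : ℕ}

theorem CellsWithin.symm (h : CellsWithin m r x c c' t) : CellsWithin m r x c' c t := by
  intro i j hi hj
  rw [SimpleGraph.edist_comm]
  exact h j i hj hi

theorem CellsWithin.mono (h : CellsWithin m r x c c' s) (hst : s ≤ t) :
    CellsWithin m r x c c' t :=
  fun i j hi hj => (h i j hi hj).trans (by exact_mod_cast hst)

theorem CellsWithin.trans (h : CellsWithin m r x c c' s) (h' : CellsWithin m r x c' c'' t)
    (hocc : ∃ i, cellOf m (x i) = c') : CellsWithin m r x c c'' (s + t) := by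
  intro i j hi hj
  obtain ⟨l, hl⟩ := hocc
  refine SimpleGraph.edist_triangle.trans ((add_le_add (h i l hi hl) (h' l j hl hj)).trans ?_)
  rw [Nat.cast_add]

/-- The indices differ by at most one in total, and the positions inside the cells add at most one
cell side per coordinate: this is the `3` in `3 / m ≤ r`. -/
theorem cellsWithin_one (hm : 1 ≤ m) (hmr : 3 / (m : ℝ) ≤ r) (hx : ∀ i, x i ∈ unitSquare)
    (h : CellsAdjacent c c') : CellsWithin m r x c c' 1 := by
  rintro i j rfl rfl
  have hm' : (0 : ℝ) < m := by exact_mod_cast hm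
  rw [Nat.cast_one]
  refine edist_le_one ((dist_le_of_cellOf hm (hx i) (hx j) le_rfl le_rfl).trans (le_trans ?_ hmr))
  unfold CellsAdjacent at h
  gcongr
  linarith

theorem cellsAdjacent_refl (c : ℕ × ℕ) : CellsAdjacent c c := by simp [CellsAdjacent]

theorem cellsWithin_path (hm : 1 ≤ m) (hmr : 3 / (m : ℝ) ≤ r) (hx : ∀ i, x i ∈ unitSquare)
    (γ : ℕ → ℕ × ℕ) (hγ : ∀ u, CellsAdjacent (γ u) (γ (u + 1))) {A N : ℕ}
    (hocc : ∀ u, A ≤ u → u < A + N → ∃ i, cellOf m (x i) = γ u) {a b : ℕ}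
    (ha : A ≤ a) (ha' : a < A + N) (hb : A ≤ b) (hb' : b < A + N) :
    CellsWithin m r x (γ a) (γ b) N := by
  -- The extra hop covers `d = 0`: two different nodes of one cell are one hop apart.
  have key : ∀ d a, A ≤ a → a + d < A + N → CellsWithin m r x (γ a) (γ (a + d)) (d + 1) := by
    intro d
    induction d with
    | zero => exact fun a _ _ => cellsWithin_one hm hmr hx (cellsAdjacent_refl _)
    | succ d ih =>
      intro a h1 h2
      exact (ih a h1 (by omega)).trans (cellsWithin_one hm hmr hx (hγ (a + d)))
        (hocc _ (by omega) (by omega))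
  rcases le_total a b with h | h
  · obtain ⟨d, rfl⟩ := Nat.exists_eq_add_of_le h
    exact (key d a ha hb').mono (by omega)
  · obtain ⟨d, rfl⟩ := Nat.exists_eq_add_of_le h
    exact (key d b hb ha').symm.mono (by omega)

/-- The bad cells in a block of `L × L` cells. -/
noncomputable def badCells (O : ℕ × ℕ → Prop) (L p q : ℕ) : Finset (ℕ × ℕ) :=
  open Classical in
  (Finset.Ico (p * L) (p * L + L) ×ˢ Finset.Ico (q * L) (q * L + L)).filter fun c => ¬ O c

/-- Pigeonhole: each bad cell spoils one of the `L` row offsets, and the two blocks together have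
fewer than `L` bad cells. -/
theorem exists_common_row (O : ℕ × ℕ → Prop) {L p q p' q' : ℕ}
    (h : (badCells O L p q).card + (badCells O L p' q').card < L) :
    ∃ v < L, (∀ u < L, O (p * L + u, q * L + v)) ∧
      ∀ u < L, O (p' * L + u, q' * L + v) := by
  classical
  by_contra! hcon
  have hsub : Finset.range L ⊆
      (badCells O L p q).image (fun c => c.2 - q * L) ∪
        (badCells O L p' q').image (fun c => c.2 - q' * L) := by
    intro v hv
    rw [Finset.mem_range] at hv
    rw [Finset.mem_union, Finset.mem_image, Finset.mem_image]
    by_cases hrow : ∀ u < L, O (p * L + u, q * L + v)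
    · obtain ⟨u, hu, hO⟩ := hcon v hv hrow
      refine Or.inr ⟨(p' * L + u, q' * L + v), ?_, by simp⟩
      · simp only [badCells, Finset.mem_filter, Finset.mem_product, Finset.mem_Ico]
        exact ⟨⟨⟨by omega, by omega⟩, by omega, by omega⟩, hO⟩
    · push Not at hrow
      obtain ⟨u, hu, hO⟩ := hrow
      refine Or.inl ⟨(p * L + u, q * L + v), ?_, by simp⟩
      · simp only [badCells, Finset.mem_filter, Finset.mem_product, Finset.mem_Ico]
        exact ⟨⟨⟨by omega, by omega⟩, by omega, by omega⟩, hO⟩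
  have := (Finset.card_le_card hsub).trans ((Finset.card_union_le _ _).trans
    (add_le_add Finset.card_image_le Finset.card_image_le))
  rw [Finset.card_range] at this
  omega

theorem card_badCells_swap (O : ℕ × ℕ → Prop) (L p q : ℕ) :
    (badCells (fun c => O c.swap) L q p).card = (badCells O L p q).card := by
  classical
  refine Finset.card_bij (fun c _ => c.swap) ?_ (fun _ _ _ _ h => Prod.swap_injective h) ?_
  · rintro ⟨a, b⟩ h
    simp only [badCells, Finset.mem_filter, Finset.mem_product, Finset.mem_Ico,
      Prod.swap_prod_mk] at h ⊢
    tauto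
  · rintro ⟨a, b⟩ h
    refine ⟨(b, a), ?_, rfl⟩
    simp only [badCells, Finset.mem_filter, Finset.mem_product, Finset.mem_Ico,
      Prod.swap_prod_mk] at h ⊢
    tauto

theorem exists_common_column (O : ℕ × ℕ → Prop) {L p q p' q' : ℕ}
    (h : (badCells O L p q).card + (badCells O L p' q').card < L) :
    ∃ u < L, (∀ v < L, O (p * L + u, q * L + v)) ∧
      ∀ v < L, O (p' * L + u, q' * L + v) := by
  have := exists_common_row (fun c => O c.swap) (L := L) (p := q) (q := p) (p' := q') (q' := p')
    (by rwa [card_badCells_swap, card_badCells_swap])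
  simpa using this

/-- If every block of `2ℓ × 2ℓ` cells has less than `ℓ` bad cells, then every block has a cell
(its hub) that is good and such that the hop distances between hubs are at most
proportional to the distances between their blocks. -/
theorem exists_hubs (hm : 1 ≤ m) (hmr : 3 / (m : ℝ) ≤ r)
    (O : ℕ × ℕ → Prop) {ℓ k : ℕ} (hℓ : 1 ≤ ℓ)
    (hbad : ∀ p < k, ∀ q < k, (badCells O (2 * ℓ) p q).card < ℓ) :
    ∃ hub : ℕ → ℕ → ℕ × ℕ, (∀ p < k, ∀ q < k, O (hub p q) ∧ (hub p q).1 / (2 * ℓ) = p ∧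
      (hub p q).2 / (2 * ℓ) = q) ∧
      ∀ x : Fin n → ℂ, (∀ i, x i ∈ unitSquare) → (∀ c, O c → ∃ i, cellOf m (x i) = c) →
      ∀ p q a b, p + a < k → q + b < k →
        CellsWithin m r x (hub p q) (hub (p + a) (q + b)) (8 * ℓ * (a + b + 1)) := by
  obtain ⟨L, hL⟩ : ∃ L, L = 2 * ℓ := ⟨_, rfl⟩
  rw [← hL] at hbad ⊢
  have hrow : ∀ p < k, ∀ q < k, ∃ v < L, ∀ u < L, O (p * L + u, q * L + v) := by
    intro p hp q hq
    have := hbad p hp q hq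
    obtain ⟨v, hv, h, -⟩ := exists_common_row O (L := L) (p := p) (q := q) (p' := p) (q' := q)
      (by omega)
    exact ⟨v, hv, h⟩
  have hcol : ∀ p < k, ∀ q < k, ∃ u < L, ∀ v < L, O (p * L + u, q * L + v) := by
    intro p hp q hq
    have := hbad p hp q hq
    obtain ⟨v, hv, h, -⟩ := exists_common_column O (L := L) (p := p) (q := q) (p' := p) (q' := q)
      (by omega)
    exact ⟨v, hv, h⟩
  choose! V hV hVO using hrow
  choose! U hU hUO using hcol
  -- The hub is the crossing of a clean column and a clean row of the block. It depends on the set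
  -- of good cells only and not on the positions `x`.
  let hub : ℕ → ℕ → ℕ × ℕ := fun p q => (p * L + U p q, q * L + V p q)
  have hubO : ∀ p < k, ∀ q < k, O (hub p q) := fun p hp q hq => hUO p hp q hq _ (hV p hp q hq)
  refine ⟨hub, fun p hp q hq => ⟨hubO p hp q hq, ?_, ?_⟩, fun x hx hO => ?_⟩
  · have := hU p hp q hq
    simp only [hub]
    rw [mul_comm, Nat.mul_add_div (by omega), Nat.div_eq_of_lt this, add_zero]
  · have := hV p hp q hq
    simp only [hub]
    rw [mul_comm, Nat.mul_add_div (by omega), Nat.div_eq_of_lt this, add_zero]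
  have hadjr : ∀ b u, CellsAdjacent (u, b) (u + 1, b) := by
    intro b u; simp [CellsAdjacent]
  have hadjc : ∀ b u, CellsAdjacent (b, u) (b, u + 1) := by
    intro b u; simp [CellsAdjacent]
  have hline : ∀ {b A N : ℕ}, (∀ u, A ≤ u → u < A + N → O (u, b)) → ∀ a a', A ≤ a → a < A + N →
      A ≤ a' → a' < A + N → CellsWithin m r x (a, b) (a', b) N := fun {b A N} h a a' h1 h2 h3 h4 =>
    cellsWithin_path hm hmr hx (fun u => (u, b)) (hadjr b) (fun u hu hu' => hO _ (h u hu hu'))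
      h1 h2 h3 h4
  have hlinec : ∀ {b A N : ℕ}, (∀ u, A ≤ u → u < A + N → O (b, u)) → ∀ a a', A ≤ a → a < A + N →
      A ≤ a' → a' < A + N → CellsWithin m r x (b, a) (b, a') N := fun {b A N} h a a' h1 h2 h3 h4 =>
    cellsWithin_path hm hmr hx (fun u => (b, u)) (hadjc b) (fun u hu hu' => hO _ (h u hu hu'))
      h1 h2 h3 h4
  have hsplit : ∀ {p u : ℕ}, p * L ≤ u → u < p * L + L → ∃ u' < L, u = p * L + u' := by
    intro p u h1 h2
    exact ⟨u - p * L, by omega, by omega⟩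
  -- The two hubs may lie in different rows: the route leaves the first hub along its clean column,
  -- crosses both blocks along a common clean row and reaches the second hub along its column. The
  -- cost is `L + 2 * L + L` hops.
  have hstepr : ∀ p q, p + 1 < k → q < k →
      CellsWithin m r x (hub p q) (hub (p + 1) q) (4 * L) := by
    intro p q hp hq
    have h1 := hbad p (by omega) q hq
    have h2 := hbad (p + 1) hp q hq
    obtain ⟨v, hv, hv1, hv2⟩ := exists_common_row O (L := L) (p := p) (q := q) (p' := p + 1)
      (q' := q) (by omega)
    have e1 : CellsWithin m r x (hub p q) (p * L + U p q, q * L + v) L := by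
      refine hlinec (A := q * L) (fun u hu hu' => ?_) _ _ ?_ ?_ ?_ ?_
      · obtain ⟨u', h, rfl⟩ := hsplit hu hu'
        exact hUO p (by omega) q hq u' h
      all_goals have := hV p (by omega) q hq; omega
    have e2 : CellsWithin m r x (p * L + U p q, q * L + v) ((p + 1) * L + U (p + 1) q, q * L + v)
        (2 * L) := by
      refine hline (A := p * L) (fun u hu hu' => ?_) _ _ ?_ ?_ ?_ ?_
      · by_cases hlt : u < p * L + L
        · obtain ⟨u', h, rfl⟩ := hsplit hu hlt
          exact hv1 u' h
        · obtain ⟨u', h, rfl⟩ := hsplit (p := p + 1) (u := u) (by rw [add_mul]; omega)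
            (by rw [add_mul]; omega)
          exact hv2 u' h
      all_goals
        have := hU p (by omega) q hq
        have := hU (p + 1) (by omega) q hq
        try rw [add_mul]
        omega
    have e3 : CellsWithin m r x ((p + 1) * L + U (p + 1) q, q * L + v) (hub (p + 1) q) L := by
      refine hlinec (A := q * L) (fun u hu hu' => ?_) _ _ ?_ ?_ ?_ ?_
      · obtain ⟨u', h, rfl⟩ := hsplit hu hu'
        exact hUO (p + 1) (by omega) q hq u' h
      all_goals have := hV (p + 1) (by omega) q hq; omega
    refine ((e1.trans e2 (hO _ ?_)).trans e3 (hO _ ?_)).mono (by omega)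
    · exact hv1 _ (hU p (by omega) q hq)
    · exact hv2 _ (hU (p + 1) (by omega) q hq)
  have hstepc : ∀ p q, p < k → q + 1 < k →
      CellsWithin m r x (hub p q) (hub p (q + 1)) (4 * L) := by
    intro p q hp hq
    have h1 := hbad p hp q (by omega)
    have h2 := hbad p hp (q + 1) hq
    obtain ⟨v, hv, hv1, hv2⟩ := exists_common_column O (L := L) (p := p) (q := q) (p' := p)
      (q' := q + 1) (by omega)
    have e1 : CellsWithin m r x (hub p q) (p * L + v, q * L + V p q) L := by
      refine hline (A := p * L) (fun u hu hu' => ?_) _ _ ?_ ?_ ?_ ?_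
      · obtain ⟨u', h, rfl⟩ := hsplit hu hu'
        exact hVO p hp q (by omega) u' h
      all_goals have := hU p hp q (by omega); omega
    have e2 : CellsWithin m r x (p * L + v, q * L + V p q) (p * L + v, (q + 1) * L + V p (q + 1))
        (2 * L) := by
      refine hlinec (A := q * L) (fun u hu hu' => ?_) _ _ ?_ ?_ ?_ ?_
      · by_cases hlt : u < q * L + L
        · obtain ⟨u', h, rfl⟩ := hsplit hu hlt
          exact hv1 u' h
        · obtain ⟨u', h, rfl⟩ := hsplit (p := q + 1) (u := u) (by rw [add_mul]; omega)
            (by rw [add_mul]; omega)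
          exact hv2 u' h
      all_goals
        have := hV p hp q (by omega)
        have := hV p hp (q + 1) (by omega)
        try rw [add_mul]
        omega
    have e3 : CellsWithin m r x (p * L + v, (q + 1) * L + V p (q + 1)) (hub p (q + 1)) L := by
      refine hline (A := p * L) (fun u hu hu' => ?_) _ _ ?_ ?_ ?_ ?_
      · obtain ⟨u', h, rfl⟩ := hsplit hu hu'
        exact hVO p hp (q + 1) (by omega) u' h
      all_goals have := hU p hp (q + 1) (by omega); omega
    refine ((e1.trans e2 (hO _ ?_)).trans e3 (hO _ ?_)).mono (by omega)
    · exact hv1 _ (hV p hp q (by omega))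
    · exact hv2 _ (hV p hp (q + 1) (by omega))
  have hchain : ∀ a p q, p + a < k → q < k →
      CellsWithin m r x (hub p q) (hub (p + a) q) (4 * L * a + 1) := by
    intro a
    induction a with
    | zero => exact fun p q _ _ => cellsWithin_one hm hmr hx (cellsAdjacent_refl _)
    | succ a ih =>
      intro p q hp hq
      refine ((ih p q (by omega) hq).trans (hstepr (p + a) q (by omega) hq)
        (hO _ (hubO _ (by omega) _ hq))).mono ?_
      rw [mul_add]; omega
  have hchain2 : ∀ b p q, p < k → q + b < k →
      CellsWithin m r x (hub p q) (hub p (q + b)) (4 * L * b + 1) := by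
    intro b
    induction b with
    | zero => exact fun p q _ _ => cellsWithin_one hm hmr hx (cellsAdjacent_refl _)
    | succ a ih =>
      intro p q hp hq
      refine ((ih p q hp (by omega)).trans (hstepc p (q + a) hp (by omega))
        (hO _ (hubO _ hp _ (by omega)))).mono ?_
      rw [mul_add]; omega
  -- The route goes horizontally to the block column of the target, then vertically. The summand `1`
  -- in `a + b + 1` absorbs the two hops spent inside cells.
  intro p q a b hp hq
  refine ((hchain a p q hp (by omega)).trans (hchain2 b (p + a) q hp hq)
    (hO _ (hubO _ hp _ (by omega)))).mono ?_
  have e : 8 * ℓ * (a + b + 1) = 4 * L * a + 4 * L * b + 4 * L := by rw [hL]; ring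
  rw [e]; omega

end Percolation

/-! ### Events of high probability -/

/-- The event `E n` has a probability that tends to one. -/
def Whp (E : ∀ n, Net n → Prop) : Prop :=
  Tendsto (fun n => netLaw n {ω | ¬ E n ω}) atTop (𝓝 0)

theorem Whp.and {E F : ∀ n, Net n → Prop} (hE : Whp E) (hF : Whp F) :
    Whp fun n ω => E n ω ∧ F n ω := by
  have h := hE.add hF
  rw [add_zero] at h
  refine tendsto_of_tendsto_of_tendsto_of_le_of_le tendsto_const_nhds h (fun _ => zero_le)
    fun n => (measure_mono ?_).trans (measure_union_le _ _)
  intro ω hω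
  simp only [Set.mem_ofPred_eq, Set.mem_union] at hω ⊢
  tauto

theorem Whp.mono {E F : ∀ n, Net n → Prop} (hE : Whp E) (h : ∀ᶠ n in atTop, ∀ ω, E n ω → F n ω) :
    Whp F := by
  refine tendsto_of_tendsto_of_tendsto_of_le_of_le' tendsto_const_nhds hE
    (Eventually.of_forall fun _ => zero_le) ?_
  filter_upwards [h] with n hn
  exact measure_mono fun ω hω hE => hω (hn ω hE)

theorem whp_of_le {E : ∀ n, Net n → Prop} {f : ℕ → ℝ} (hf : Tendsto f atTop (𝓝 0))
    (h : ∀ᶠ n in atTop, netLaw n {ω | ¬ E n ω} ≤ ENNReal.ofReal (f n)) : Whp E := by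
  have h0 : Tendsto (fun n => ENNReal.ofReal (f n)) atTop (𝓝 0) := by
    simpa [Function.comp_def] using (ENNReal.continuous_ofReal.tendsto 0).comp hf
  exact tendsto_of_tendsto_of_tendsto_of_le_of_le' tendsto_const_nhds h0
    (Eventually.of_forall fun _ => zero_le) h

/-- Arithmetic of the union bounds: at most `B * n` events, each of probability at most `1 / n ^ 2`.
-/
theorem card_mul_exp_le {N n : ℕ} {B t : ℝ} (hn : 1 ≤ n) (hN : (N : ℝ) ≤ B * n)
    (ht : 2 * Real.log n ≤ t) :
    (N : ENNReal) * ENNReal.ofReal (rexp (-t)) ≤ ENNReal.ofReal (B / n) := by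
  have hn' : (0 : ℝ) < n := by exact_mod_cast hn
  rw [← ENNReal.ofReal_natCast, ← ENNReal.ofReal_mul (by positivity)]
  refine ENNReal.ofReal_le_ofReal ?_
  have h1 : rexp (-t) ≤ 1 / (n : ℝ) ^ 2 := by
    calc rexp (-t) ≤ rexp (-(2 * Real.log n)) := exp_le_exp.mpr (by linarith)
      _ = 1 / (n : ℝ) ^ 2 := by
        rw [exp_neg, show 2 * Real.log n = Real.log n + Real.log n by ring, exp_add,
          Real.exp_log hn', inv_eq_one_div]
        ring
  calc (N : ℝ) * rexp (-t) ≤ B * n * (1 / (n : ℝ) ^ 2) :=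
        mul_le_mul hN h1 (exp_pos _).le ((Nat.cast_nonneg N).trans hN)
    _ = B / n := by field_simp

theorem tendsto_const_div_natCast (B : ℝ) : Tendsto (fun n : ℕ => B / n) atTop (𝓝 0) :=
  tendsto_const_nhds.div_atTop tendsto_natCast_atTop_atTop

theorem netLaw_biUnion_le {n : ℕ} {τ : Type*} (J : Finset τ) (E : τ → Net n → Prop) {δ : ENNReal}
    (h : ∀ j ∈ J, netLaw n {ω | E j ω} ≤ δ) : netLaw n {ω | ∃ j ∈ J, E j ω} ≤ J.card * δ := by
  have e : {ω | ∃ j ∈ J, E j ω} = ⋃ j ∈ J, {ω | E j ω} := by ext; simp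
  rw [e]
  refine (measure_biUnion_finset_le J _).trans ((Finset.sum_le_sum h).trans ?_)
  rw [Finset.sum_const, nsmul_eq_mul]

theorem netLaw_positions_upper {n : ℕ} {τ : Type*} (J : Finset τ) (A : τ → Set ℂ)
    (hA : ∀ j ∈ J, MeasurableSet (A j)) {μ : ℝ}
    (hμ : ∀ j ∈ J, n * ((volume : Measure ℂ).restrict unitSquare).real (A j) ≤ μ) :
    netLaw n {ω | ∃ j ∈ J, 4 * μ ≤ ({i | ω.1 i ∈ A j} : Set (Fin n)).ncard} ≤
      J.card * ENNReal.ofReal (rexp (-(2 * μ))) := by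
  refine netLaw_biUnion_le J _ fun j hj => ?_
  refine (netLaw_positions_le
    {x | 4 * μ ≤ ({i | x i ∈ A j} : Set (Fin n)).ncard}).trans ?_
  rw [← neg_mul]
  refine measure_pi_four_mul_le _ (fun _ => A j) (fun _ => hA j hj) ?_
  simpa using hμ j hj

theorem netLaw_positions_lower {n : ℕ} {τ : Type*} (J : Finset τ) (A : τ → Set ℂ)
    (hA : ∀ j ∈ J, MeasurableSet (A j)) {μ : ℝ} (h0 : 0 ≤ μ)
    (hμ : ∀ j ∈ J, μ ≤ n * ((volume : Measure ℂ).restrict unitSquare).real (A j)) :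
    netLaw n {ω | ∃ j ∈ J, (({i | ω.1 i ∈ A j} : Set (Fin n)).ncard : ℝ) ≤ μ / 4} ≤
      J.card * ENNReal.ofReal (rexp (-(μ / 4))) := by
  refine netLaw_biUnion_le J _ fun j hj => ?_
  refine (netLaw_positions_le
    {x | (({i | x i ∈ A j} : Set (Fin n)).ncard : ℝ) ≤ μ / 4}).trans ?_
  refine measure_pi_le_quarter _ (fun _ => A j) (fun _ => hA j hj) h0 ?_
  simpa using hμ j hj

theorem measurableSet_unitSquare : MeasurableSet unitSquare :=
  (Complex.measurable_re measurableSet_Ico).inter (Complex.measurable_im measurableSet_Ico)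

theorem netLaw_unitSquare (n : ℕ) : netLaw n {ω | ¬ ∀ i, ω.1 i ∈ unitSquare} = 0 := by
  refine le_antisymm ((netLaw_positions_le {x | ¬ ∀ i, x i ∈ unitSquare}).trans ?_) zero_le
  have e : {x : Fin n → ℂ | ¬ ∀ i, x i ∈ unitSquare} = ⋃ i, (fun x => x i) ⁻¹' unitSquareᶜ := by
    ext; simp
  rw [e]
  refine (measure_iUnion_le _).trans (le_of_eq ?_)
  rw [tsum_fintype]
  refine Finset.sum_eq_zero fun i _ => ?_
  rw [(measurePreserving_eval (fun _ : Fin n => (volume : Measure ℂ).restrict unitSquare)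
    i).measure_preimage measurableSet_unitSquare.compl.nullMeasurableSet,
    Measure.restrict_apply measurableSet_unitSquare.compl]
  simp

theorem whp_unitSquare : Whp fun _ ω => ∀ i, ω.1 i ∈ unitSquare := by
  simp only [Whp, netLaw_unitSquare]
  exact tendsto_const_nhds

/-! ### Occupancy of the grid cells. -/

/-- The number of nodes in a cell of the grid, for nodes in the cells `y i`. -/
noncomputable def cellCount {n : ℕ} (y : Fin n → ℕ × ℕ) (c : ℕ × ℕ) : ℕ :=
  ({i | y i = c} : Set (Fin n)).ncard

theorem ncard_mem_cells_eq_sum {n : ℕ} (y : Fin n → ℕ × ℕ) (S : Finset (ℕ × ℕ)) :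
    ({i | y i ∈ S} : Set (Fin n)).ncard = ∑ c ∈ S, cellCount y c := by
  classical
  simp only [cellCount, Set.ncard_eq_toFinset_card', Set.toFinset_ofPred]
  rw [Finset.card_eq_sum_card_fiberwise (f := y) (t := S) (fun i hi => by simpa using hi)]
  refine Finset.sum_congr rfl fun c hc => ?_
  congr 1
  ext i
  simp only [Finset.mem_filter, Finset.mem_univ, true_and]
  exact ⟨fun h => h.2, fun h => ⟨h ▸ hc, h⟩⟩

/-- The cells of the `m × m` grid. -/
def gridCells (m : ℕ) : Finset (ℕ × ℕ) := Finset.range m ×ˢ Finset.range m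

theorem mem_gridCells {m : ℕ} {c : ℕ × ℕ} : c ∈ gridCells m ↔ c.1 < m ∧ c.2 < m := by
  simp [gridCells]

theorem card_gridCells (m : ℕ) : (gridCells m).card = m ^ 2 := by
  simp [gridCells, sq]

theorem badCells_subset_gridCells (O : ℕ × ℕ → Prop) {L k p q : ℕ} (hp : p < k) (hq : q < k) :
    badCells O L p q ⊆ gridCells (L * k) := by
  intro c hc
  simp only [badCells, Finset.mem_filter, Finset.mem_product, Finset.mem_Ico] at hc
  have h1 : (p + 1) * L ≤ L * k := by rw [mul_comm]; exact Nat.mul_le_mul_left _ hp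
  have h2 : (q + 1) * L ≤ L * k := by rw [mul_comm]; exact Nat.mul_le_mul_left _ hq
  rw [add_mul, one_mul] at h1 h2
  rw [mem_gridCells]
  omega

/-- No cell contains more than a constant times the average number of nodes. -/
theorem netLaw_cellCount_upper {n m : ℕ} (hm : 1 ≤ m) {μ : ℝ} (hμ : (n : ℝ) / (m : ℝ) ^ 2 ≤ μ) :
    netLaw n {ω | ∃ c ∈ gridCells m, 4 * μ ≤ cellCount (fun i => cellOf m (ω.1 i)) c} ≤
      (m ^ 2 : ℕ) * ENNReal.ofReal (rexp (-(2 * μ))) := by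
  rw [← card_gridCells]
  refine netLaw_positions_upper (gridCells m) (fun c => {z | cellOf m z = c})
    (fun c _ => measurable_cellOf m (measurableSet_singleton c)) fun c hc => ?_
  have h := restrict_unitSquare_cells hm {c} (by simpa using mem_gridCells.mp hc)
  simp only [Finset.mem_singleton, Finset.card_singleton, Nat.cast_one] at h
  rw [h]
  simpa [div_eq_mul_inv] using hμ

/-- In every block of `L × L` cells, less than `ℓ` cells contain less than a quarter of the
average number of nodes. -/
theorem netLaw_badCells {n L k ℓ : ℕ} (hm : 1 ≤ L * k) {μ : ℝ}
    (hμ : μ = (n : ℝ) / ((L * k : ℕ) : ℝ) ^ 2) :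
    netLaw n {ω | ∃ p ∈ gridCells k,
      ℓ ≤ (badCells (fun c => μ / 4 < cellCount (fun i => cellOf (L * k) (ω.1 i)) c)
        L p.1 p.2).card} ≤
      (k ^ 2 * 2 ^ (L ^ 2) : ℕ) * ENNReal.ofReal (rexp (-(ℓ * μ / 4))) := by
  classical
  set block : ℕ × ℕ → Finset (ℕ × ℕ) := fun p =>
    Finset.Ico (p.1 * L) (p.1 * L + L) ×ˢ Finset.Ico (p.2 * L) (p.2 * L + L) with hblock
  have hcard : ∀ p, (block p).card = L ^ 2 := by intro p; simp [hblock, sq]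
  have hgrid : ∀ p ∈ gridCells k, block p ⊆ gridCells (L * k) := by
    intro p hp
    have := badCells_subset_gridCells (fun _ => False) (L := L) (mem_gridCells.mp hp).1
      (mem_gridCells.mp hp).2
    simpa [badCells] using this
  -- The union bound runs over the blocks and over the sets of `ℓ` cells in a block. If all `ℓ`
  -- cells are bad, their union holds at most a quarter of its mean `ℓ * μ`; the lower tail for the
  -- union has the factor `ℓ` in its exponent, whereas a single cell would only give `exp (-μ / 4)`.
  set J : Finset (Σ _ : ℕ × ℕ, Finset (ℕ × ℕ)) :=
    (gridCells k).sigma fun p => (block p).powersetCard ℓ with hJ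
  have hJcard : J.card ≤ k ^ 2 * 2 ^ (L ^ 2) := by
    rw [hJ, Finset.card_sigma, ← card_gridCells, ← smul_eq_mul]
    refine Finset.sum_le_card_nsmul _ _ _ fun p _ => ?_
    rw [Finset.card_powersetCard, hcard]
    exact Nat.choose_le_two_pow _ _
  have hμ0 : 0 ≤ μ := by rw [hμ]; positivity
  have h := netLaw_positions_lower (n := n) J (fun s => {z | cellOf (L * k) z ∈ s.2})
    (fun s _ => measurable_cellOf _ s.2.measurableSet) (μ := ℓ * μ) (by positivity) (by
      rintro ⟨p, s⟩ hs
      simp only [hJ, Finset.mem_sigma, Finset.mem_powersetCard] at hs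
      rw [restrict_unitSquare_cells hm s fun q hq => mem_gridCells.mp (hgrid p hs.1 (hs.2.1 hq)),
        hs.2.2, hμ]
      apply le_of_eq
      ring)
  refine (measure_mono ?_).trans (h.trans (by gcongr))
  rintro ω ⟨p, hp, hbad⟩
  obtain ⟨s, hs, hsc⟩ := Finset.exists_subset_card_eq hbad
  refine ⟨⟨p, s⟩, ?_, ?_⟩
  · rw [hJ, Finset.mem_sigma]
    exact ⟨hp, Finset.mem_powersetCard.mpr ⟨hs.trans (Finset.filter_subset _ _), hsc⟩⟩
  · simp only [Set.mem_ofPred_eq]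
    rw [ncard_mem_cells_eq_sum (fun i => cellOf (L * k) (ω.1 i)) s, Nat.cast_sum]
    calc _ ≤ ∑ c ∈ s, μ / 4 := by
          refine Finset.sum_le_sum fun c hc => ?_
          have := hs hc
          simp only [badCells, Finset.mem_filter, not_lt] at this
          exact this.2
      _ = _ := by rw [Finset.sum_const, hsc, nsmul_eq_mul]; ring

/-! ### Flows in ad hoc mode -/

/-- The cells at most `N` cells away from `c`, in each coordinate. -/
def boxCells (N : ℕ) (c : ℕ × ℕ) : Finset (ℕ × ℕ) :=
  Finset.Icc (c.1 - N) (c.1 + N) ×ˢ Finset.Icc (c.2 - N) (c.2 + N)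

theorem card_boxCells_le (N : ℕ) (c : ℕ × ℕ) : (boxCells N c).card ≤ (2 * N + 1) ^ 2 := by
  rw [boxCells, Finset.card_product, Nat.card_Icc, Nat.card_Icc, sq]
  gcongr <;> omega

/-- `H` hops span a distance of at most `H * r`, that is `4 * H` cell sides; rounding to indices
adds one, which is at most `H`. -/
theorem mem_boxCells_of_isAdHoc {n m H : ℕ} {r : ℝ} (hr : 0 ≤ r) (hmr : m * r ≤ 4) (hH : 1 ≤ H)
    {ω : Net n} (hω : ∀ i, ω.1 i ∈ unitSquare) {i : Fin n} (h : IsAdHoc r H ω i) :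
    cellOf m (ω.1 (ω.2 i)) ∈ boxCells (5 * H) (cellOf m (ω.1 i)) := by
  have hd := (dist_le_of_edist_le hr h).1
  obtain ⟨h1, h2⟩ := cellOf_sub_le_of_dist (m := m) (hω i) (hω (ω.2 i))
  have hH' : (1 : ℝ) ≤ H := by exact_mod_cast hH
  have hmd : m * dist (ω.1 i) (ω.1 (ω.2 i)) + 1 ≤ 5 * H := by
    calc m * dist (ω.1 i) (ω.1 (ω.2 i)) + 1 ≤ m * (H * r) + 1 := by gcongr
      _ = H * (m * r) + 1 := by ring
      _ ≤ H * 4 + H := by gcongr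
      _ = 5 * H := by ring
  have h1' := abs_le.mp (h1.trans hmd)
  have h2' := abs_le.mp (h2.trans hmd)
  have e : ∀ a b : ℕ, -(5 * H : ℝ) ≤ (a : ℝ) - b ∧ (a : ℝ) - b ≤ 5 * H →
      a - 5 * H ≤ b ∧ b ≤ a + 5 * H := by
    rintro a b ⟨u1, u2⟩
    have v1 : (b : ℝ) ≤ ((a + 5 * H : ℕ) : ℝ) := by push_cast; linarith
    have v2 : (a : ℝ) ≤ ((b + 5 * H : ℕ) : ℝ) := by push_cast; linarith
    have w1 : b ≤ a + 5 * H := by exact_mod_cast v1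
    have w2 : a ≤ b + 5 * H := by exact_mod_cast v2
    omega
  rw [boxCells, Finset.mem_product, Finset.mem_Icc, Finset.mem_Icc]
  exact ⟨e _ _ h1', e _ _ h2'⟩

theorem sum_ncard_boxCells_le {n : ℕ} (y : Fin n → ℕ × ℕ) {B : ℝ}
    (hB : ∀ c, (cellCount y c : ℝ) ≤ B) (N : ℕ) :
    ∑ i, (({j | y j ∈ boxCells N (y i)} : Set (Fin n)).ncard : ℝ) ≤
      n * ((2 * N + 1) ^ 2 * B) := by
  have hB0 : 0 ≤ B := (Nat.cast_nonneg _).trans (hB (0, 0))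
  calc _ ≤ ∑ _i : Fin n, ((2 * N + 1) ^ 2 * B : ℝ) := by
        refine Finset.sum_le_sum fun i _ => ?_
        rw [ncard_mem_cells_eq_sum, Nat.cast_sum]
        calc _ ≤ ∑ c ∈ boxCells N (y i), B := Finset.sum_le_sum fun c _ => hB c
          _ = (boxCells N (y i)).card * B := by rw [Finset.sum_const, nsmul_eq_mul]
          _ ≤ _ := by
            gcongr
            exact_mod_cast card_boxCells_le N (y i)
    _ = _ := by simp

theorem sum_ite_le_ncard_mul {n : ℕ} (p : Fin n → Prop) [DecidablePred p] (f : Fin n → ℝ) {B : ℝ}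
    (hB : 0 ≤ B) (W : Set (Fin n)) (hW : ∀ i, p i → i ∈ W ∧ f i ≤ B) :
    ∑ i, (if p i then f i else 0) ≤ W.ncard * B := by
  classical
  calc _ ≤ ∑ i, if i ∈ W then B else 0 := by
        refine Finset.sum_le_sum fun i _ => ?_
        by_cases hp : p i
        · rw [if_pos hp, if_pos (hW i hp).1]
          exact (hW i hp).2
        · rw [if_neg hp]
          split_ifs <;> linarith
    _ = _ := by
        rw [← Finset.sum_filter, Finset.sum_const, nsmul_eq_mul, Set.ncard_eq_toFinset_card']
        congr 3
        ext; simp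

theorem ncard_mul_le_sum_ite {n : ℕ} (p : Fin n → Prop) [DecidablePred p] (f : Fin n → ℝ) {b : ℝ}
    (hf : ∀ i, p i → 0 ≤ f i) (W : Set (Fin n)) (hW : ∀ i ∈ W, p i ∧ b ≤ f i) :
    W.ncard * b ≤ ∑ i, (if p i then f i else 0) := by
  classical
  calc (W.ncard : ℝ) * b = ∑ i, if i ∈ W then b else 0 := by
        rw [← Finset.sum_filter, Finset.sum_const, nsmul_eq_mul, Set.ncard_eq_toFinset_card']
        congr 3
        ext; simp
    _ ≤ _ := by
        refine Finset.sum_le_sum fun i _ => ?_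
        by_cases hi : i ∈ W
        · rw [if_pos hi, if_pos (hW i hi).1]
          exact (hW i hi).2
        · rw [if_neg hi]
          split_ifs with hp
          · exact hf i hp
          · exact le_rfl

theorem avgDelayAdHoc_le {n m H : ℕ} {r c₁ c₂ : ℝ} (hr : 0 ≤ r) (hmr : m * r ≤ 4) (hH : 1 ≤ H)
    {dwell : Fin n → ℕ → ℝ} (hd : ∀ i k, c₁ ≤ dwell i k ∧ dwell i k ≤ c₂)
    {ω : Net n} (hω : ∀ i, ω.1 i ∈ unitSquare) (hc₂ : 0 ≤ c₂) :
    avgDelayAdHoc r H dwell ω ≤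
      (({i | ω.2 i ∈ {j | cellOf m (ω.1 j) ∈ boxCells (5 * H) (cellOf m (ω.1 i))}} :
        Set (Fin n)).ncard : ℝ) * (H * c₂) / n := by
  classical
  unfold avgDelayAdHoc
  gcongr
  refine sum_ite_le_ncard_mul _ _ (by positivity) _ fun i hi =>
    ⟨mem_boxCells_of_isAdHoc hr hmr hH hω hi, ?_⟩
  have hle := (dist_le_of_edist_le hr hi).2.1
  calc adHocPacketDelay r dwell ω i ≤ ∑ _k ∈ Finset.range ((hopGraph r ω.1).dist i (ω.2 i)), c₂ :=
        Finset.sum_le_sum fun k _ => (hd i k).2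
    _ = (hopGraph r ω.1).dist i (ω.2 i) * c₂ := by simp
    _ ≤ H * c₂ := by gcongr

/-- The destinations that are reached in at most `H` hops, but not in less than `H / A` hops,
whatever the positions of the nodes within their cells. -/
def longRoutes {n : ℕ} (m H : ℕ) (r A : ℝ) (y : Fin n → ℕ × ℕ) (i : Fin n) : Set (Fin n) :=
  {j | j ≠ i ∧ ∀ x : Fin n → ℂ, (∀ i, x i ∈ unitSquare) → (∀ i, cellOf m (x i) = y i) →
    (hopGraph r x).edist i j ≤ (H : ℕ∞) ∧ (H : ℝ) ≤ A * (hopGraph r x).dist i j}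

theorem le_avgDelayAdHoc {n m H : ℕ} {r c₁ c₂ A : ℝ} (hA : 0 < A)
    (hc₁ : 0 ≤ c₁) {dwell : Fin n → ℕ → ℝ} (hd : ∀ i k, c₁ ≤ dwell i k ∧ dwell i k ≤ c₂)
    {ω : Net n} (hω : ∀ i, ω.1 i ∈ unitSquare) :
    (({i | ω.2 i ∈ longRoutes m H r A (fun i => cellOf m (ω.1 i)) i} : Set (Fin n)).ncard : ℝ) *
      (H / A * c₁) / n ≤ avgDelayAdHoc r H dwell ω := by
  have hge : ∀ i, (hopGraph r ω.1).dist i (ω.2 i) * c₁ ≤ adHocPacketDelay r dwell ω i := by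
    intro i
    calc (hopGraph r ω.1).dist i (ω.2 i) * c₁ =
          ∑ _k ∈ Finset.range ((hopGraph r ω.1).dist i (ω.2 i)), c₁ := by simp
      _ ≤ _ := Finset.sum_le_sum fun k _ => (hd i k).1
  classical
  unfold avgDelayAdHoc
  gcongr
  refine ncard_mul_le_sum_ite _ _ (fun i _ => (by positivity : (0 : ℝ) ≤ _).trans (hge i)) _
    fun i hi => ?_
  obtain ⟨h1, h2⟩ := hi.2 ω.1 hω fun _ => rfl
  refine ⟨h1, le_trans ?_ (hge i)⟩
  gcongr
  rw [div_le_iff₀ hA]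
  linarith

theorem card_mul_le_sum_cells {n : ℕ} (y : Fin n → ℕ × ℕ) (S : Finset (ℕ × ℕ)) {b g : ℝ}
    (hg : 0 ≤ g) (hb : ∀ c ∈ S, b ≤ cellCount y c) (f : Fin n → ℝ) (hf : ∀ i, 0 ≤ f i)
    (hfg : ∀ i, y i ∈ S → g ≤ f i) : S.card * b * g ≤ ∑ i, f i := by
  classical
  have h1 := ncard_mul_le_sum_ite (fun _ => True) f (b := g) (fun i _ => hf i) {i | y i ∈ S}
    fun i hi => ⟨trivial, hfg i hi⟩
  simp only [if_true] at h1
  refine le_trans ?_ h1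
  gcongr
  rw [ncard_mem_cells_eq_sum, Nat.cast_sum]
  calc (S.card : ℝ) * b = ∑ c ∈ S, b := by rw [Finset.sum_const, nsmul_eq_mul]
    _ ≤ _ := Finset.sum_le_sum hb

theorem card_mul_le_ncard_cells {n : ℕ} (y : Fin n → ℕ × ℕ) (S : Finset (ℕ × ℕ)) {b : ℝ}
    (hb : ∀ c ∈ S, b ≤ cellCount y c) (W : Set (Fin n)) (hW : ∀ i, y i ∈ S → i ∈ W) :
    S.card * b ≤ W.ncard := by
  have h : ({i | y i ∈ S} : Set (Fin n)).ncard ≤ W.ncard :=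
    Set.ncard_le_ncard (fun i hi => hW i hi) (Set.toFinite _)
  refine le_trans ?_ (Nat.cast_le.mpr h)
  rw [ncard_mem_cells_eq_sum, Nat.cast_sum]
  calc (S.card : ℝ) * b = ∑ c ∈ S, b := by rw [Finset.sum_const, nsmul_eq_mul]
    _ ≤ _ := Finset.sum_le_sum hb

/-- Sources and destinations are taken in hub cells only, one out of `4 * ℓ ^ 2` cells of a block
but with more than `μ / 4` nodes each. This loses only powers of `ℓ`, which is a constant. -/
theorem sum_longRoutes_ge {n ℓ k m H : ℕ} {r μ : ℝ} (hℓ : 1 ≤ ℓ) (hk : 1 ≤ k)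
    (hm : m = 2 * ℓ * k) (hr : 0 < r) (hmr : 3 ≤ m * r) (hmr' : m * r ≤ 4)
    (hμ : μ = (n : ℝ) / (m : ℝ) ^ 2)
    (hμ8 : 8 ≤ μ) (hH : 1 ≤ H) (hHk : 4 * (H / (24 * ℓ)) ≤ k) (y : Fin n → ℕ × ℕ)
    (hbad : ∀ p < k, ∀ q < k,
      (badCells (fun c => μ / 4 < cellCount y c) (2 * ℓ) p q).card < ℓ) :
    (H : ℝ) ^ 2 * μ / (48 ^ 2 * 256 * (ℓ : ℝ) ^ 4) * n ≤
      ∑ i, ((longRoutes m H r (96 * ℓ) y i \ {i}).ncard : ℝ) := by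
  classical
  have hℓ' : (1 : ℝ) ≤ ℓ := by exact_mod_cast hℓ
  have hk' : (1 : ℝ) ≤ k := by exact_mod_cast hk
  have hm1 : 1 ≤ m := by rw [hm]; exact Nat.mul_pos (by omega) hk
  have hm0 : (0 : ℝ) < m := by exact_mod_cast hm1
  have hmc : (m : ℝ) = 2 * ℓ * k := by rw [hm]; push_cast; ring
  have hnk : (k : ℝ) ^ 2 * μ = n / (4 * (ℓ : ℝ) ^ 2) := by
    rw [hμ, hmc]; field_simp; ring
  obtain ⟨hub, hhub, hwithin⟩ := exists_hubs (n := n) (m := m) (r := r) hm1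
    ((div_le_iff₀ hm0).mpr (by linarith)) (fun c => μ / 4 < cellCount y c) hℓ hbad
  have hocc : ∀ x : Fin n → ℂ, (∀ i, cellOf m (x i) = y i) → ∀ c, μ / 4 < cellCount y c →
      ∃ i, cellOf m (x i) = c := by
    intro x hx c hc
    have h0 : 0 < cellCount y c := by
      have : (0 : ℝ) < cellCount y c := by linarith
      exact_mod_cast this
    obtain ⟨i, hi⟩ := (Set.ncard_pos (Set.toFinite _)).mp h0
    exact ⟨i, (hx i).trans hi⟩
  have hdist1 : ∀ (x : Fin n → ℂ) (i j : Fin n) (t : ℕ), j ≠ i →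
      (hopGraph r x).edist i j ≤ (t : ℕ∞) → 1 ≤ (hopGraph r x).dist i j := by
    intro x i j t hne h
    have hreach : (hopGraph r x).Reachable i j := SimpleGraph.edist_ne_top_iff_reachable.mp
      (ne_top_of_le_ne_top (ENat.natCast_ne_top t) h)
    exact hreach.pos_dist_of_ne hne.symm
  have hinj : ∀ p < k, ∀ q < k, ∀ p' < k, ∀ q' < k, hub p q = hub p' q' → p = p' ∧ q = q' := by
    intro p hp q hq p' hp' q' hq' h
    obtain ⟨-, h1, h2⟩ := hhub p hp q hq
    obtain ⟨-, h3, h4⟩ := hhub p' hp' q' hq'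
    rw [h] at h1 h2
    exact ⟨h1.symm.trans h3, h2.symm.trans h4⟩
  have hcardimg : ∀ (N : ℕ) (a b : ℕ), a + N ≤ k → b + N ≤ k →
      ((Finset.range N ×ˢ Finset.range N).image fun s : ℕ × ℕ => hub (a + s.1) (b + s.2)).card =
        N ^ 2 := by
    intro N a b ha hb
    rw [Finset.card_image_of_injOn, Finset.card_product, Finset.card_range, sq]
    rintro ⟨s, t⟩ hs ⟨s', t'⟩ hs' h
    simp only [Finset.coe_product, Finset.coe_range, Set.mem_prod, Set.mem_Iio] at hs hs'
    have := hinj _ (by omega) _ (by omega) _ (by omega) _ (by omega) h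
    ext <;> simp only <;> omega
  by_cases hsmall : H < 24 * ℓ
  · -- destinations in the same cell
    set S := (Finset.range k ×ˢ Finset.range k).image fun s : ℕ × ℕ => hub (0 + s.1) (0 + s.2)
      with hS
    have hScount : ∀ c ∈ S, μ / 4 ≤ cellCount y c := by
      intro c hc
      simp only [hS, Finset.mem_image, Finset.mem_product, Finset.mem_range] at hc
      obtain ⟨s, ⟨h1, h2⟩, rfl⟩ := hc
      exact (hhub _ (by omega) _ (by omega)).1.le
    have hmain := card_mul_le_sum_cells y S (b := μ / 4) (g := μ / 8) (by linarith) hScount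
      (fun i => ((longRoutes m H r (96 * ℓ) y i \ {i}).ncard : ℝ)) (fun i => by positivity) (by
        intro i hi
        -- For bounded `H` a single hop is already long enough. The source itself is excluded, and
        -- `8 ≤ μ` ensures `μ / 4 - 1 ≥ μ / 8`.
        have hsub : {j | y j = y i} \ {i} ⊆ longRoutes m H r (96 * ℓ) y i \ {i} := by
          rintro j ⟨hj, hji⟩
          refine ⟨⟨hji, fun x hx hxy => ?_⟩, hji⟩
          have h1 : (hopGraph r x).edist i j ≤ ((1 : ℕ) : ℕ∞) :=
            cellsWithin_one hm1 ((div_le_iff₀ hm0).mpr (by linarith)) hx (cellsAdjacent_refl (y i))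
              i j (hxy i) ((hxy j).trans hj)
          refine ⟨h1.trans (by exact_mod_cast hH), ?_⟩
          have h2 : (1 : ℝ) ≤ (hopGraph r x).dist i j := by exact_mod_cast hdist1 x i j 1 hji h1
          have h3 : (H : ℝ) ≤ 24 * ℓ := by exact_mod_cast hsmall.le
          nlinarith
        have h1 := Set.ncard_le_ncard hsub (Set.toFinite _)
        have h2 := Set.ncard_sdiff_singleton_add_one (s := {j | y j = y i}) (a := i) rfl
          (Set.toFinite _)
        have h3 : ((({j | y j = y i} : Set (Fin n)) \ {i}).ncard : ℝ) + 1 = cellCount y (y i) := by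
          exact_mod_cast h2
        have h4 := hScount _ hi
        have h5 : ((({j | y j = y i} : Set (Fin n)) \ {i}).ncard : ℝ) ≤
          (longRoutes m H r (96 * ℓ) y i \ {i}).ncard := by exact_mod_cast h1
        linarith)
    rw [hS, hcardimg k 0 0 (by omega) (by omega), Nat.cast_pow] at hmain
    refine le_trans ?_ hmain
    have h3 : (H : ℝ) ≤ 24 * ℓ := by exact_mod_cast hsmall.le
    calc (H : ℝ) ^ 2 * μ / (48 ^ 2 * 256 * (ℓ : ℝ) ^ 4) * n ≤
          (24 * ℓ : ℝ) ^ 2 * μ / (48 ^ 2 * 256 * (ℓ : ℝ) ^ 4) * n := by gcongr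
      _ = n / (4 * (ℓ : ℝ) ^ 2) * μ / 256 := by field_simp; ring
      _ ≤ n / (4 * (ℓ : ℝ) ^ 2) * μ / 32 := by gcongr; norm_num
      _ = (k : ℝ) ^ 2 * (μ / 4) * (μ / 8) := by rw [← hnk]; ring
  · -- destinations in blocks at a distance of order `H`
    push Not at hsmall
    set k₀ := H / (24 * ℓ) with hk₀
    have hk₀1 : 1 ≤ k₀ := (Nat.one_le_div_iff (by omega)).mpr hsmall
    have hk₀H : 24 * ℓ * k₀ ≤ H := Nat.mul_div_le H (24 * ℓ)
    have hHk₀ : H < 24 * ℓ * (k₀ + 1) := Nat.lt_mul_div_succ H (by omega)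
    have hHk₀' : (H : ℝ) ≤ 48 * ℓ * k₀ := by
      have : H ≤ 48 * ℓ * k₀ := by nlinarith [Nat.mul_le_mul_left (24 * ℓ) hk₀1]
      exact_mod_cast this
    set S := (Finset.range (k - 2 * k₀) ×ˢ Finset.range (k - 2 * k₀)).image
      fun s : ℕ × ℕ => hub (0 + s.1) (0 + s.2) with hS
    have hmain := card_mul_le_sum_cells y S (b := μ / 4) (g := (k₀ : ℝ) ^ 2 * (μ / 4))
      (by positivity) (by
        intro c hc
        simp only [hS, Finset.mem_image, Finset.mem_product, Finset.mem_range] at hc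
        obtain ⟨s, ⟨h1, h2⟩, rfl⟩ := hc
        exact (hhub _ (by omega) _ (by omega)).1.le)
      (fun i => ((longRoutes m H r (96 * ℓ) y i \ {i}).ncard : ℝ)) (fun i => by positivity) (by
        intro i hi
        simp only [hS, Finset.mem_image, Finset.mem_product, Finset.mem_range, zero_add] at hi
        obtain ⟨⟨p, q⟩, ⟨hp, hq⟩, hi⟩ := hi
        simp only at hp hq hi
        -- These blocks lie more than `k₀` columns to the right of the source. Their hubs are within
        -- `8ℓ * 3k₀ ≤ H` hops, yet more than `2ℓ * k₀` cells away; a hop advances by at most four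
        -- cell sides, so a route has at least `ℓ * k₀ / 2` hops, which is of order `H`.
        set S' := (Finset.range k₀ ×ˢ Finset.range k₀).image
          fun s : ℕ × ℕ => hub (p + k₀ + 1 + s.1) (q + s.2) with hS'
        have := card_mul_le_ncard_cells y S' (b := μ / 4) (by
          intro c hc
          simp only [hS', Finset.mem_image, Finset.mem_product, Finset.mem_range] at hc
          obtain ⟨s, ⟨h1, h2⟩, rfl⟩ := hc
          exact (hhub _ (by omega) _ (by omega)).1.le)
          (longRoutes m H r (96 * ℓ) y i \ {i}) (by
            intro j hj
            simp only [hS', Finset.mem_image, Finset.mem_product, Finset.mem_range] at hj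
            obtain ⟨⟨a, b⟩, ⟨ha, hb⟩, hj⟩ := hj
            simp only at ha hb hj
            obtain ⟨-, hi1, -⟩ := hhub p (by omega) q (by omega)
            obtain ⟨-, hj1, -⟩ := hhub (p + k₀ + 1 + a) (by omega) (q + b) (by omega)
            rw [hi] at hi1
            rw [hj] at hj1
            have hcell : (y i).1 + 2 * ℓ * k₀ + 1 ≤ (y j).1 := by
              have u1 : (y i).1 < 2 * ℓ * (p + 1) := by
                rw [← hi1]; exact Nat.lt_mul_div_succ _ (by omega)
              have u2 : 2 * ℓ * (p + k₀ + 1 + a) ≤ (y j).1 := by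
                rw [← hj1]; exact Nat.mul_div_le _ _
              have u3 : 2 * ℓ * (p + k₀ + 1 + a) = 2 * ℓ * (p + 1) + 2 * ℓ * k₀ + 2 * ℓ * a := by
                ring
              omega
            have hji : j ≠ i := by rintro rfl; omega
            refine ⟨⟨hji, fun x hx hxy => ?_⟩, hji⟩
            have hw := hwithin x hx (hocc x hxy) p q (k₀ + 1 + a) b (by omega) (by omega) i j
              ((hxy i).trans hi.symm) ((hxy j).trans (by rw [← hj]; congr 1; omega))
            have hw' : (hopGraph r x).edist i j ≤ (H : ℕ∞) := by
              refine hw.trans ?_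
              have : 8 * ℓ * (k₀ + 1 + a + b + 1) ≤ H :=
                calc 8 * ℓ * (k₀ + 1 + a + b + 1) ≤ 8 * ℓ * (3 * k₀) :=
                      Nat.mul_le_mul_left _ (by omega)
                  _ = 24 * ℓ * k₀ := by ring
                  _ ≤ H := hk₀H
              exact_mod_cast this
            refine ⟨hw', ?_⟩
            have h1 := (dist_le_of_edist_le hr.le hw').2.2
            have h2 := (abs_le.mp (cellOf_sub_le_of_dist (m := m) (hx i) (hx j)).1).1
            rw [hxy, hxy] at h2
            have h3 : ((y i).1 : ℝ) + 2 * ℓ * k₀ + 1 ≤ (y j).1 := by exact_mod_cast hcell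
            have h4 : m * dist (x i) (x j) ≤ 4 * (hopGraph r x).dist i j := by
              calc m * dist (x i) (x j) ≤ m * ((hopGraph r x).dist i j * r) := by gcongr
                _ = (m * r) * (hopGraph r x).dist i j := by ring
                _ ≤ _ := by gcongr
            have h5 : (2 : ℝ) * ℓ * k₀ ≤ 4 * (hopGraph r x).dist i j := by linarith
            have h6 : (0 : ℝ) ≤ (hopGraph r x).dist i j := by positivity
            nlinarith)
        rwa [hS', hcardimg k₀ (p + k₀ + 1) q (by omega) (by omega), Nat.cast_pow] at this)
    rw [hS, hcardimg (k - 2 * k₀) 0 0 (by omega) (by omega), Nat.cast_pow] at hmain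
    refine le_trans ?_ hmain
    -- Keeping the sources `2 * k₀` blocks away from the far borders leaves room for the
    -- destinations and retains at least half of the blocks in each direction.
    have hhalf : (k : ℝ) / 2 ≤ ((k - 2 * k₀ : ℕ) : ℝ) := by
      rw [Nat.cast_sub (by omega)]
      have : (4 : ℝ) * k₀ ≤ k := by exact_mod_cast hHk
      push_cast
      linarith
    calc (H : ℝ) ^ 2 * μ / (48 ^ 2 * 256 * (ℓ : ℝ) ^ 4) * n ≤
          (48 * ℓ * k₀ : ℝ) ^ 2 * μ / (48 ^ 2 * 256 * (ℓ : ℝ) ^ 4) * n := by gcongr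
      _ = n / (4 * (ℓ : ℝ) ^ 2) * μ * (k₀ : ℝ) ^ 2 / 64 := by field_simp; ring
      _ = ((k : ℝ) / 2) ^ 2 * (μ / 4) * ((k₀ : ℝ) ^ 2 * (μ / 4)) := by rw [← hnk]; ring
      _ ≤ _ := by gcongr

/-! ### Flows in infrastructure mode -/

/-- `station m` serves below also as the centre of a cell of the fine grid, where no base station is
meant. -/
theorem dist_station_le {m : ℕ} (hm : 1 ≤ m) {z : ℂ} (hz : z ∈ unitSquare) :
    dist z (station m (cellOf m z)) ≤ 1 / m := by
  have hm' : (0 : ℝ) < m := by exact_mod_cast hm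
  obtain ⟨a1, a2, a3, a4⟩ := le_of_cellOf (b := m) hz
  rw [dist_eq_norm]
  refine (Complex.norm_le_abs_re_add_abs_im _).trans ?_
  simp only [station, Complex.sub_re, Complex.sub_im]
  have key : ∀ t c : ℝ, c ≤ m * t → m * t < c + 1 → |t - (c + 1 / 2) / m| ≤ 1 / 2 / m := by
    intro t c h1 h2
    have e : t - (c + 1 / 2) / m = (m * t - c - 1 / 2) / m := by field_simp; ring
    rw [e, abs_div, abs_of_pos hm']
    gcongr
    rw [abs_le]
    constructor <;> linarith
  calc _ ≤ 1 / 2 / (m : ℝ) + 1 / 2 / m := add_le_add (key _ _ a1 a2) (key _ _ a3 a4)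
    _ = _ := by ring

/-- The cells that are too far away from the cell `c` for a route of at most `H` hops. -/
def FarCell (m H : ℕ) (r : ℝ) (c c' : ℕ × ℕ) : Prop :=
  H * r + 2 / m < dist (station m c) (station m c')

theorem not_isAdHoc_of_farCell {n m H : ℕ} {r : ℝ} (hm : 1 ≤ m) (hr : 0 ≤ r) {ω : Net n}
    (hω : ∀ i, ω.1 i ∈ unitSquare) {i : Fin n}
    (h : FarCell m H r (cellOf m (ω.1 i)) (cellOf m (ω.1 (ω.2 i)))) : ¬ IsAdHoc r H ω i := by
  intro hi
  have h1 := (dist_le_of_edist_le hr hi).1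
  have h2 := dist_station_le hm (hω i)
  have h3 := dist_station_le hm (hω (ω.2 i))
  unfold FarCell at h
  have h4 := dist_triangle4 (station m (cellOf m (ω.1 i))) (ω.1 i) (ω.1 (ω.2 i))
    (station m (cellOf m (ω.1 (ω.2 i))))
  rw [dist_comm] at h2
  have e : (2 : ℝ) / m = 1 / m + 1 / m := by ring
  linarith

/-- Points of the square in cells that are not far lie in a disc of radius `H * r + 3 / m`: `2 / m`
is the slack in `FarCell` and `1 / m` the passage from a cell centre to the point. -/
theorem restrict_unitSquare_farCell {m H : ℕ} {r δ : ℝ} (hm : 1 ≤ m) (hr : 0 ≤ r)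
    (hδ : π * (H * r + 3 / m) ^ 2 ≤ 1 - δ) (c : ℕ × ℕ) :
    δ ≤ ((volume : Measure ℂ).restrict unitSquare).real {z | FarCell m H r c (cellOf m z)} := by
  have hmeas : MeasurableSet {z | FarCell m H r c (cellOf m z)} :=
    measurable_cellOf m (Set.to_countable {c' | FarCell m H r c c'}).measurableSet
  have hcompl := probReal_compl_eq_one_sub (μ := (volume : Measure ℂ).restrict unitSquare) hmeas
  have hle : ((volume : Measure ℂ).restrict unitSquare).real {z | FarCell m H r c (cellOf m z)}ᶜ ≤
      ((volume : Measure ℂ).restrict unitSquare).real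
        {z | dist (station m c) z ≤ H * r + 3 / m} := by
    refine ENNReal.toReal_mono (measure_ne_top _ _) (measure_mono_ae ?_)
    filter_upwards [ae_restrict_mem measurableSet_unitSquare] with z hz hfar
    have h1 : dist (station m c) (station m (cellOf m z)) ≤ H * r + 2 / m := not_lt.mp hfar
    have h2 := dist_station_le hm hz
    rw [dist_comm] at h2
    have h3 := dist_triangle (station m c) (station m (cellOf m z)) z
    change dist (station m c) z ≤ H * r + 3 / m
    have e : (3 : ℝ) / m = 2 / m + 1 / m := by ring
    linarith
  have := restrict_unitSquare_disc (station m c) (ρ := H * r + 3 / m) (by positivity)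
  linarith

/-- The BS-cell of a point, together with the sector in which its base station sees it. -/
noncomputable def bsSector (b P : ℕ) (z : ℂ) : (ℕ × ℕ) × ℕ :=
  (cellOf b z, sectorIndex P (z - station b (cellOf b z)))

theorem measurable_bsSector (b P : ℕ) : Measurable (bsSector b P) :=
  (measurable_cellOf b).prodMk ((measurable_sectorIndex P).comp
    (measurable_id.sub ((measurable_of_countable (station b)).comp (measurable_cellOf b))))

theorem bsSector_fiber (b P : ℕ) (s : (ℕ × ℕ) × ℕ) : {z | bsSector b P z = s} =
    {z | cellOf b z = s.1 ∧ sectorIndex P (z - station b s.1) = s.2} := by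
  obtain ⟨q, k⟩ := s
  ext z
  simp only [bsSector, Set.mem_ofPred_eq, Prod.mk.injEq]
  constructor
  · rintro ⟨h1, h2⟩
    exact ⟨h1, by rw [← h1]; exact h2⟩
  · rintro ⟨h1, h2⟩
    exact ⟨h1, by rw [h1]; exact h2⟩

/-- Both rounds take at most `2 * T` slots. The bound on the multiplicity of destinations is needed
for the downlink, where one node may receive several flows; in the uplink each node has a single
flow. -/
theorem avgDelayInfra_le {n H b C T : ℕ} {r θ c : ℝ} (hθ0 : 0 < θ) (hθ : θ ≤ π) (hC : 1 ≤ C)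
    (hc : 0 ≤ c) (hT : 1 ≤ T) {ω : Net n}
    (hup : ∀ s, ({i | bsSector b ⌊2 * π / θ⌋₊ (ω.1 i) = s} : Set (Fin n)).ncard ≤ C * T)
    (hdown : ∀ s, ({i | bsSector b ⌊2 * π / θ⌋₊ (ω.1 (ω.2 i)) = s} : Set (Fin n)).ncard ≤ C * T)
    (hmul : ∀ j, ({i | ω.2 i = j} : Set (Fin n)).ncard ≤ T) :
    avgDelayInfra r H b C θ c ω ≤ 4 * T * slotLength n b c := by
  classical
  have hslot : 0 ≤ slotLength n b c := by unfold slotLength; positivity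
  have h1 : ∀ q, uplinkRound r H b C θ ω q ≤ 2 * T := by
    intro q
    refine roundLength_le hθ0 hθ hC _ _ _ _ (fun k _ => ?_) fun j => ?_
    · refine (Set.ncard_le_ncard ?_ (Set.toFinite _)).trans (hup (q, k))
      rintro i ⟨⟨-, hi⟩, hk⟩
      simp only [Set.mem_ofPred_eq, bsSector, hi]
      rw [← hk]
      rfl
    · refine (Set.ncard_le_ncard (t := {j}) ?_ (Set.toFinite _)).trans ?_
      · rintro i ⟨-, hi⟩
        exact hi
      · rw [Set.ncard_singleton]; exact hT
  have h2 : ∀ q, downlinkRound r H b C θ ω q ≤ 2 * T := by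
    intro q
    refine roundLength_le hθ0 hθ hC _ _ _ _ (fun k _ => ?_) fun j => ?_
    · refine (Set.ncard_le_ncard ?_ (Set.toFinite _)).trans (hdown (q, k))
      rintro i ⟨⟨-, hi⟩, hk⟩
      simp only [Set.mem_ofPred_eq, bsSector, hi]
      rw [← hk]
    · exact (Set.ncard_le_ncard (fun i hi => hi.2) (Set.toFinite _)).trans (hmul j)
  unfold avgDelayInfra
  rcases Nat.eq_zero_or_pos n with hn | hn
  · subst hn
    simp only [Nat.cast_zero, div_zero]
    positivity
  have hn' : (0 : ℝ) < n := by exact_mod_cast hn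
  rw [div_le_iff₀ hn']
  calc _ ≤ ∑ _i : Fin n, 4 * T * slotLength n b c := by
        refine Finset.sum_le_sum fun i _ => ?_
        split_ifs
        · positivity
        · unfold infraPacketDelay
          gcongr
          have u1 : (uplinkRound r H b C θ ω (cellOf b (ω.1 i)) : ℝ) ≤ 2 * T := by
            exact_mod_cast h1 _
          have u2 : (downlinkRound r H b C θ ω (cellOf b (ω.1 (ω.2 i))) : ℝ) ≤ 2 * T := by
            exact_mod_cast h2 _
          linarith
    _ = _ := by simp [mul_comm]

/-- The `|F q|` flows of a cell each wait at least `|F q| / M` slots for the uplink, and the sum of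
the squares is at least `N ^ 2 / b ^ 2` by Cauchy–Schwarz. Uneven cells only increase the delay, so
no concentration per cell is needed; the downlink is discarded. -/
theorem le_avgDelayInfra {n H b C : ℕ} {r θ c N : ℝ} (hθ0 : 0 < θ) (hθ : θ ≤ π) (hC : 1 ≤ C)
    (hb : 1 ≤ b) (hn : 1 ≤ n) (hc : 0 ≤ c) {ω : Net n} (hω : ∀ i, ω.1 i ∈ unitSquare)
    (hN0 : 0 ≤ N) (hN : N ≤ ({i | ¬ IsAdHoc r H ω i} : Set (Fin n)).ncard) :
    (N / n) ^ 2 * (c / (⌊2 * π / θ⌋₊ * C : ℕ)) ≤ avgDelayInfra r H b C θ c ω := by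
  classical
  have hP := (floor_beams hθ0 hθ).1
  set M := ⌊2 * π / θ⌋₊ * C with hM
  have hM1 : 1 ≤ M := Nat.mul_pos (by omega) hC
  have hM' : (0 : ℝ) < M := by exact_mod_cast hM1
  have hn' : (0 : ℝ) < n := by exact_mod_cast hn
  have hb' : (0 : ℝ) < b := by exact_mod_cast hb
  set F : ℕ × ℕ → Finset (Fin n) := fun q =>
    Finset.univ.filter fun i => ¬ IsAdHoc r H ω i ∧ cellOf b (ω.1 i) = q with hF
  have hround : ∀ q, ((F q).card : ℝ) ≤ M * uplinkRound r H b C θ ω q := by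
    intro q
    have h := ncard_le_mul_roundLength hθ0 hθ hC (station b q) ω.1 id
      {i | ¬ IsAdHoc r H ω i ∧ cellOf b (ω.1 i) = q}
    rw [Set.ncard_eq_toFinset_card', Set.toFinset_ofPred] at h
    exact_mod_cast h
  have hfib : ∀ f : Fin n → ℝ, ∑ i, (if IsAdHoc r H ω i then 0 else f i) =
      ∑ q ∈ gridCells b, ∑ i ∈ F q, f i := by
    intro f
    rw [← Finset.sum_fiberwise_of_maps_to (t := gridCells b) (g := fun i => cellOf b (ω.1 i))
      (fun i _ => mem_gridCells.mpr (cellOf_lt hb (hω i)))]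
    refine Finset.sum_congr rfl fun q _ => ?_
    rw [hF, Finset.sum_filter, Finset.sum_filter]
    refine Finset.sum_congr rfl fun i _ => ?_
    by_cases h1 : IsAdHoc r H ω i <;> by_cases h2 : cellOf b (ω.1 i) = q <;> simp [h1, h2]
  have hcount : N ≤ ∑ q ∈ gridCells b, ((F q).card : ℝ) := by
    refine hN.trans (le_of_eq ?_)
    have h1 := hfib fun _ => 1
    simp only [Finset.sum_const, nsmul_eq_mul, mul_one] at h1
    rw [← h1, Set.ncard_eq_toFinset_card', Set.toFinset_ofPred, Finset.card_eq_sum_ones,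
      Finset.sum_filter, Nat.cast_sum]
    refine Finset.sum_congr rfl fun i _ => ?_
    split_ifs <;> simp_all
  have hsq : (∑ q ∈ gridCells b, ((F q).card : ℝ)) ^ 2 ≤
      (b : ℝ) ^ 2 * ∑ q ∈ gridCells b, ((F q).card : ℝ) ^ 2 := by
    have := sq_sum_le_card_mul_sum_sq (s := gridCells b) (f := fun q => ((F q).card : ℝ))
    rwa [card_gridCells, Nat.cast_pow] at this
  have hsum : ∑ q ∈ gridCells b, ((F q).card : ℝ) ^ 2 ≤
      M * ∑ q ∈ gridCells b, ∑ i ∈ F q, (uplinkRound r H b C θ ω (cellOf b (ω.1 i)) : ℝ) := by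
    rw [Finset.mul_sum]
    refine Finset.sum_le_sum fun q _ => ?_
    have e : ∑ i ∈ F q, (uplinkRound r H b C θ ω (cellOf b (ω.1 i)) : ℝ) =
        (F q).card * uplinkRound r H b C θ ω q := by
      rw [← nsmul_eq_mul, ← Finset.sum_const]
      refine Finset.sum_congr rfl fun i hi => ?_
      rw [(Finset.mem_filter.mp hi).2.2]
    rw [e, sq]
    calc ((F q).card : ℝ) * (F q).card ≤ (F q).card * (M * uplinkRound r H b C θ ω q) := by
          gcongr
          exact hround q
      _ = _ := by ring
  have hdelay : (∑ q ∈ gridCells b, ∑ i ∈ F q, (uplinkRound r H b C θ ω (cellOf b (ω.1 i)) : ℝ)) *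
      slotLength n b c / n ≤ avgDelayInfra r H b C θ c ω := by
    unfold avgDelayInfra
    rw [← hfib, Finset.sum_mul]
    gcongr with i
    split_ifs
    · simp
    · unfold infraPacketDelay
      have hs : 0 ≤ slotLength n b c := by unfold slotLength; positivity
      gcongr
      simp
  refine le_trans ?_ hdelay
  have hfinal : N ^ 2 ≤ (b : ℝ) ^ 2 * (M * ∑ q ∈ gridCells b, ∑ i ∈ F q,
      (uplinkRound r H b C θ ω (cellOf b (ω.1 i)) : ℝ)) := by
    calc N ^ 2 ≤ (∑ q ∈ gridCells b, ((F q).card : ℝ)) ^ 2 := by gcongr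
      _ ≤ _ := hsq
      _ ≤ _ := by gcongr
  unfold slotLength
  calc (N / n) ^ 2 * (c / M) = N ^ 2 * (c / (M * n ^ 2)) := by field_simp
    _ ≤ ((b : ℝ) ^ 2 * (M * ∑ q ∈ gridCells b, ∑ i ∈ F q,
      (uplinkRound r H b C θ ω (cellOf b (ω.1 i)) : ℝ))) * (c / (M * n ^ 2)) := by gcongr
    _ = _ := by field_simp

/-! ### Scales -/

/-- A grid of `m × m` cells, divided into `k × k` blocks, that is adapted to the transmission
range `r` of a network of `n` nodes; `μ` is the average number of nodes in a cell. -/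
structure GridScale (K : ℝ) (ℓ n k m : ℕ) (r μ : ℝ) : Prop where
  r_pos : 0 < r
  k_pos : 1 ≤ k
  m_eq : m = 2 * ℓ * k
  three_le : 3 ≤ m * r
  le_four : m * r ≤ 4
  mean_eq : μ = (n : ℝ) / (m : ℝ) ^ 2
  log_le : Real.log n / 51 ≤ μ
  mean_le : μ ≤ K ^ 2 * Real.log n / 9
  sq_le : m ^ 2 ≤ n
  m_pos : 1 ≤ m
  le_k : 3 / (2 * ℓ * r) ≤ k

theorem tendsto_log_natCast : Tendsto (fun n : ℕ => Real.log n) atTop atTop :=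
  Real.tendsto_log_atTop.comp tendsto_natCast_atTop_atTop

theorem tendsto_log_div_natCast : Tendsto (fun n : ℕ => Real.log n / n) atTop (𝓝 0) :=
  (Real.isLittleO_log_id_atTop.tendsto_div_nhds_zero).comp tendsto_natCast_atTop_atTop

theorem tendsto_sqrt_log_div (K : ℝ) : Tendsto (fun n : ℕ => K * √(Real.log n / n)) atTop (𝓝 0) := by
  have := ((Real.continuous_sqrt.tendsto 0).comp tendsto_log_div_natCast).const_mul K
  simpa [Function.comp_def] using this

theorem eventually_range_lt {K : ℝ} {r : ℕ → ℝ}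
    (hr : ∀ᶠ n : ℕ in atTop, √(Real.log n / (π * n)) < r n ∧ r n ≤ K * √(Real.log n / n))
    {δ : ℝ} (hδ : 0 < δ) : ∀ᶠ n : ℕ in atTop, 0 < r n ∧ r n < δ := by
  filter_upwards [hr, (tendsto_sqrt_log_div K).eventually_lt_const hδ] with n h1 h2
  exact ⟨(Real.sqrt_nonneg _).trans_lt h1.1, h1.2.trans_lt h2⟩

theorem eventually_gridScale {K : ℝ} {r : ℕ → ℝ} {ℓ : ℕ} (hℓ : 1 ≤ ℓ)
    (hr : ∀ᶠ n : ℕ in atTop, √(Real.log n / (π * n)) < r n ∧ r n ≤ K * √(Real.log n / n)) :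
    ∃ (k m : ℕ → ℕ) (μ : ℕ → ℝ), ∀ᶠ n in atTop, GridScale K ℓ n (k n) (m n) (r n) (μ n) := by
  have hℓ' : (1 : ℝ) ≤ ℓ := by exact_mod_cast hℓ
  -- The least number of blocks for which `3 ≤ m * r`. Rounding up adds at most `2 * ℓ * r < 1`,
  -- whence `m * r ≤ 4`; the mean is then at least `log n / (16 * π)`, and `16 * π < 51`.
  refine ⟨fun n => ⌈3 / (2 * ℓ * r n)⌉₊, fun n => 2 * ℓ * ⌈3 / (2 * ℓ * r n)⌉₊,
    fun n => (n : ℝ) / ((2 * ℓ * ⌈3 / (2 * ℓ * r n)⌉₊ : ℕ) : ℝ) ^ 2, ?_⟩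
  filter_upwards [hr, eventually_range_lt hr (δ := 1 / (2 * ℓ)) (by positivity),
    tendsto_log_natCast.eventually_ge_atTop 51, eventually_ge_atTop 1] with n hn hn2 hlog hn1
  obtain ⟨h0, h1⟩ := hn2
  have hn' : (0 : ℝ) < n := by exact_mod_cast hn1
  set ρ := r n with hρ
  set k := ⌈3 / (2 * ℓ * ρ)⌉₊ with hk
  have hk1 : 1 ≤ k := Nat.one_le_iff_ne_zero.mpr (Nat.ceil_pos.mpr (by positivity)).ne'
  have hkle : 3 / (2 * ℓ * ρ) ≤ k := Nat.le_ceil _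
  have hklt : (k : ℝ) < 3 / (2 * ℓ * ρ) + 1 := Nat.ceil_lt_add_one (by positivity)
  set m := 2 * ℓ * k with hm
  have hmc : (m : ℝ) = 2 * ℓ * k := by rw [hm]; push_cast; ring
  have hm1 : 1 ≤ m := Nat.mul_pos (by omega) hk1
  have hm' : (0 : ℝ) < m := by exact_mod_cast hm1
  have h3 : 3 ≤ m * ρ := by
    rw [div_le_iff₀ (by positivity)] at hkle
    rw [hmc]; linarith
  have h4 : m * ρ ≤ 4 := by
    rw [lt_div_iff₀ (by positivity)] at h1
    have : 2 * ℓ * ρ * k ≤ 2 * ℓ * ρ * (3 / (2 * ℓ * ρ) + 1) := by gcongr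
    have e : 2 * ℓ * ρ * (3 / (2 * ℓ * ρ) + 1) = 3 + 2 * ℓ * ρ := by field_simp
    rw [hmc]; linarith
  have hsq : Real.log n / (π * n) ≤ ρ ^ 2 := (Real.sqrt_le_left h0.le).mp hn.1.le
  have hsq2 : ρ ^ 2 ≤ K ^ 2 * (Real.log n / n) := by
    have hnn : 0 ≤ Real.log n / n := by positivity
    calc ρ ^ 2 ≤ (K * √(Real.log n / n)) ^ 2 := by gcongr; exact hn.2
      _ = _ := by rw [mul_pow, Real.sq_sqrt hnn]
  have hlow : Real.log n / 51 ≤ (n : ℝ) / (m : ℝ) ^ 2 := by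
    have e1 : Real.log n ≤ ρ ^ 2 * (π * n) := (div_le_iff₀ (by positivity)).mp hsq
    have e2 : (m * ρ) ^ 2 ≤ 4 ^ 2 := by gcongr
    rw [div_le_div_iff₀ (by norm_num) (by positivity)]
    calc Real.log n * (m : ℝ) ^ 2 ≤ ρ ^ 2 * (π * n) * (m : ℝ) ^ 2 := by gcongr
      _ = (m * ρ) ^ 2 * (π * n) := by ring
      _ ≤ 4 ^ 2 * (π * n) := by gcongr
      _ ≤ n * 51 := by nlinarith [pi_lt_d2]
  have hup : (n : ℝ) / (m : ℝ) ^ 2 ≤ K ^ 2 * Real.log n / 9 := by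
    have e2 : 3 ^ 2 ≤ (m * ρ) ^ 2 := by gcongr
    have e3 : ρ ^ 2 * n ≤ K ^ 2 * Real.log n := by
      calc ρ ^ 2 * n ≤ K ^ 2 * (Real.log n / n) * n := by gcongr
        _ = _ := by field_simp
    rw [div_le_div_iff₀ (by positivity) (by norm_num)]
    calc (n : ℝ) * 9 = 3 ^ 2 * n := by ring
      _ ≤ (m * ρ) ^ 2 * n := by gcongr
      _ = ρ ^ 2 * n * (m : ℝ) ^ 2 := by ring
      _ ≤ _ := by gcongr
  refine ⟨h0, hk1, hm, h3, h4, rfl, hlow, hup, ?_, hm1, hkle⟩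
  have h5 : 1 ≤ (n : ℝ) / (m : ℝ) ^ 2 := by linarith
  rw [le_div_iff₀ (by positivity), one_mul] at h5
  exact_mod_cast h5

/-! ### Regularity of the positions -/

theorem whp_cellCount_le {K : ℝ} {ℓ : ℕ} {k m : ℕ → ℕ} {r μ : ℕ → ℝ}
    (hs : ∀ᶠ n in atTop, GridScale K ℓ n (k n) (m n) (r n) (μ n)) :
    Whp fun n ω => ∀ c, (cellCount (fun i => cellOf (m n) (ω.1 i)) c : ℝ) ≤ 400 * μ n := by
  have h : Whp fun n ω => ∀ c ∈ gridCells (m n),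
      (cellCount (fun i => cellOf (m n) (ω.1 i)) c : ℝ) < 400 * μ n := by
    refine whp_of_le (tendsto_const_div_natCast 1) ?_
    filter_upwards [hs, eventually_ge_atTop 1, tendsto_log_natCast.eventually_ge_atTop 51]
      with n hn hn1 hlog
    have hμ := hn.log_le
    -- The mean is inflated by `100` so that the exponent `200 * μ` exceeds `2 * log n` although `μ`
    -- may be as small as `log n / 51`.
    have h1 := netLaw_cellCount_upper (n := n) hn.m_pos (μ := 100 * μ n) (by
      rw [← hn.mean_eq]; linarith)
    refine (measure_mono ?_).trans (h1.trans (card_mul_exp_le hn1 ?_ ?_))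
    · intro ω hω
      simp only [Set.mem_ofPred_eq, not_forall, not_lt] at hω ⊢
      obtain ⟨c, hc, hle⟩ := hω
      exact ⟨c, hc, by linarith⟩
    · rw [one_mul]; exact_mod_cast hn.sq_le
    · linarith
  refine (h.and whp_unitSquare).mono ?_
  filter_upwards [hs] with n hn ω hω c
  by_cases hc : c ∈ gridCells (m n)
  · exact (hω.1 c hc).le
  · have h0 : ({i | cellOf (m n) (ω.1 i) = c} : Set (Fin n)) = ∅ := by
      ext i
      simp only [Set.mem_ofPred_eq, Set.mem_empty_iff_false, iff_false]
      rintro rfl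
      exact hc (mem_gridCells.mpr (cellOf_lt hn.m_pos (hω.2 i)))
    rw [cellCount, h0, Set.ncard_empty, hn.mean_eq]
    simp only [Nat.cast_zero]
    positivity

/-- The condition `500 ≤ ℓ` makes `ℓ * μ / 4 ≥ (500 / 204) * log n`, which beats the union bound
over at most `n` blocks; the number of subsets per block is a constant. -/
theorem whp_badCells {K : ℝ} {ℓ : ℕ} (hℓ : 500 ≤ ℓ) {k m : ℕ → ℕ} {r μ : ℕ → ℝ}
    (hs : ∀ᶠ n in atTop, GridScale K ℓ n (k n) (m n) (r n) (μ n)) :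
    Whp fun n ω => ∀ p < k n, ∀ q < k n,
      (badCells (fun c => μ n / 4 < cellCount (fun i => cellOf (m n) (ω.1 i)) c)
        (2 * ℓ) p q).card < ℓ := by
  refine whp_of_le (tendsto_const_div_natCast (2 ^ ((2 * ℓ) ^ 2))) ?_
  filter_upwards [hs, eventually_ge_atTop 1, tendsto_log_natCast.eventually_ge_atTop 51]
    with n hn hn1 hlog
  have hμ := hn.log_le
  have hℓ' : (500 : ℝ) ≤ ℓ := by exact_mod_cast hℓ
  have hmk : 2 * ℓ * k n = m n := hn.m_eq.symm
  have h1 := netLaw_badCells (n := n) (L := 2 * ℓ) (k := k n) (ℓ := ℓ) (μ := μ n)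
    (by rw [hmk]; exact hn.m_pos) (by rw [hmk]; exact hn.mean_eq)
  rw [hmk] at h1
  refine (measure_mono ?_).trans (h1.trans (card_mul_exp_le hn1 ?_ ?_))
  · intro ω hω
    simp only [Set.mem_ofPred_eq, not_forall, not_lt] at hω ⊢
    obtain ⟨p, hp, q, hq, hle⟩ := hω
    exact ⟨(p, q), mem_gridCells.mpr ⟨hp, hq⟩, hle⟩
  · push_cast
    rw [mul_comm]
    gcongr
    have h2 : k n ≤ m n := by rw [hn.m_eq]; exact Nat.le_mul_of_pos_left _ (by omega)
    exact_mod_cast (Nat.pow_le_pow_left h2 2).trans hn.sq_le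
  · nlinarith

/-! ### The average delay of ad hoc communications -/

theorem whp_avgDelayAdHoc_le {K c₁ c₂ : ℝ} (hc₂ : 0 ≤ c₂) {ℓ : ℕ} {k m : ℕ → ℕ}
    {r μ : ℕ → ℝ} (hs : ∀ᶠ n in atTop, GridScale K ℓ n (k n) (m n) (r n) (μ n)) {H : ℕ → ℕ}
    (hH : ∀ n, 1 ≤ H n) {dwell : ∀ n : ℕ, Net n → Fin n → ℕ → ℝ}
    (hd : ∀ n ω i k, c₁ ≤ dwell n ω i k ∧ dwell n ω i k ≤ c₂) :
    Whp fun n ω => avgDelayAdHoc (r n) (H n) (dwell n ω) ω ≤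
      (387200 * K ^ 2 / 9 * c₂) * ((H n : ℝ) ^ 3 * Real.log n / n) := by
  have h : Whp fun n ω =>
      (∀ c, (cellCount (fun i => cellOf (m n) (ω.1 i)) c : ℝ) ≤ 400 * μ n) →
      (({i | ω.2 i ∈ {j | cellOf (m n) (ω.1 j) ∈ boxCells (5 * H n) (cellOf (m n) (ω.1 i))}} :
        Set (Fin n)).ncard : ℝ) < 4 * (96800 * (H n : ℝ) ^ 2 * μ n) := by
    refine whp_of_le (tendsto_const_div_natCast 1) ?_
    filter_upwards [hs, eventually_ge_atTop 2, tendsto_log_natCast.eventually_ge_atTop 51]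
      with n hn hn2 hlog
    have hμ := hn.log_le
    have hH' : (1 : ℝ) ≤ H n := by exact_mod_cast hH n
    have hn2' : (2 : ℝ) ≤ n := by exact_mod_cast hn2
    -- The box has at most `(11 * H) ^ 2` cells of at most `400 * μ` nodes, and `n ≤ 2 * (n - 1)`:
    -- `96800 = 2 * 11 ^ 2 * 400`.
    have h1 := netLaw_flows_upper hn2 (measurable_cellOf (m n))
      (fun y => ∀ c, (cellCount y c : ℝ) ≤ 400 * μ n)
      (fun y i => {j | y j ∈ boxCells (5 * H n) (y i)}) (m := 96800 * (H n : ℝ) ^ 2 * μ n) (by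
        intro y hy
        refine (sum_ncard_boxCells_le y hy (5 * H n)).trans ?_
        push_cast
        calc (n : ℝ) * ((2 * (5 * H n) + 1) ^ 2 * (400 * μ n)) ≤
              (2 * (n - 1)) * ((11 * H n) ^ 2 * (400 * μ n)) := by
              have hμ0 : 0 ≤ μ n := by linarith
              gcongr
              all_goals linarith
          _ = _ := by ring)
    refine (measure_mono ?_).trans (h1.trans ?_)
    · intro ω hω
      simp only [Set.mem_ofPred_eq, Classical.not_imp, not_lt] at hω ⊢
      exact hω
    · have h2 := card_mul_exp_le (N := 1) (n := n) (B := 1)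
        (t := 2 * (96800 * (H n : ℝ) ^ 2 * μ n)) (by omega) (by push_cast; linarith) (by
          have : 1 ≤ (H n : ℝ) ^ 2 := one_le_pow₀ hH'
          nlinarith)
      rwa [Nat.cast_one, one_mul, ← neg_mul] at h2
  refine ((h.and (whp_cellCount_le hs)).and whp_unitSquare).mono ?_
  filter_upwards [hs, eventually_ge_atTop 1] with n hn hn1 ω hω
  have hn' : (0 : ℝ) < n := by exact_mod_cast hn1
  refine (avgDelayAdHoc_le hn.r_pos.le hn.le_four (hH n) (hd n ω) hω.2 hc₂).trans ?_
  have h1 := (hω.1.1 hω.1.2).le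
  have h2 := hn.mean_le
  calc _ ≤ 4 * (96800 * (H n : ℝ) ^ 2 * μ n) * (H n * c₂) / n := by
        gcongr
        exact h1
    _ ≤ 4 * (96800 * (H n : ℝ) ^ 2 * (K ^ 2 * Real.log n / 9)) * (H n * c₂) / n := by gcongr
    _ = _ := by ring

theorem whp_le_avgDelayAdHoc {K c₁ c₂ : ℝ} (hc₁ : 0 < c₁) {ℓ : ℕ} (hℓ : 500 ≤ ℓ)
    {k m : ℕ → ℕ}
    {r μ : ℕ → ℝ} (hs : ∀ᶠ n in atTop, GridScale K ℓ n (k n) (m n) (r n) (μ n)) {H : ℕ → ℕ}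
    (hH : ∀ n, 1 ≤ H n) (hHr : ∀ᶠ n in atTop, H n * r n ≤ 1)
    {dwell : ∀ n : ℕ, Net n → Fin n → ℕ → ℝ}
    (hd : ∀ n ω i k, c₁ ≤ dwell n ω i k ∧ dwell n ω i k ≤ c₂) :
    Whp fun n ω => (c₁ / (51 * 384 * ℓ * (48 ^ 2 * 256 * (ℓ : ℝ) ^ 4))) *
      ((H n : ℝ) ^ 3 * Real.log n / n) ≤ avgDelayAdHoc (r n) (H n) (dwell n ω) ω := by
  have hℓ' : (500 : ℝ) ≤ ℓ := by exact_mod_cast hℓ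
  set κ : ℝ := 48 ^ 2 * 256 * (ℓ : ℝ) ^ 4 with hκ
  have hκ0 : 0 < κ := by positivity
  have h : Whp fun n ω =>
      (∀ p < k n, ∀ q < k n,
      (badCells (fun c => μ n / 4 < cellCount (fun i => cellOf (m n) (ω.1 i)) c)
        (2 * ℓ) p q).card < ℓ) →
      ((H n : ℝ) ^ 2 * μ n / κ) / 4 <
        (({i | ω.2 i ∈ longRoutes (m n) (H n) (r n) (96 * ℓ) (fun i => cellOf (m n) (ω.1 i)) i} :
        Set (Fin n)).ncard : ℝ) := by
    -- A small negative power of `n` suffices here, since the total number of long routes is a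
    -- single event.
    have hlim : Tendsto (fun n : ℕ => rexp (-(1 / (51 * κ * 4) * Real.log n))) atTop (𝓝 0) :=
      Real.tendsto_exp_neg_atTop_nhds_zero.comp
        (tendsto_log_natCast.const_mul_atTop (by positivity))
    refine whp_of_le hlim ?_
    filter_upwards [hs, hHr, eventually_ge_atTop 2, tendsto_log_natCast.eventually_ge_atTop 408]
      with n hn hHn hn2 hlog
    have hμ := hn.log_le
    have hμ0 : 0 ≤ μ n := by linarith
    have hH' : (1 : ℝ) ≤ H n := by exact_mod_cast hH n
    -- Since `H * r ≤ 1`, the targeted routes fit into the square.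
    have hHk : 4 * (H n / (24 * ℓ)) ≤ k n := by
      have e1 : ((H n / (24 * ℓ) : ℕ) : ℝ) ≤ H n / (24 * ℓ) := by
        have := Nat.cast_div_le (α := ℝ) (m := H n) (n := 24 * ℓ)
        push_cast at this
        exact this
      have e2 := hn.le_k
      have hr0 := hn.r_pos
      have e3 : 4 * ((H n : ℝ) / (24 * ℓ)) ≤ 3 / (2 * ℓ * r n) := by
        rw [mul_div_assoc', div_le_div_iff₀ (by positivity) (by positivity)]
        calc 4 * (H n : ℝ) * (2 * ℓ * r n) = 8 * ℓ * (H n * r n) := by ring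
          _ ≤ 8 * ℓ * 1 := by gcongr
          _ ≤ 3 * (24 * ℓ) := by linarith
      have e4 : (4 : ℝ) * ((H n / (24 * ℓ) : ℕ) : ℝ) ≤ k n := by linarith
      exact_mod_cast e4
    have h1 := netLaw_flows_lower hn2 (measurable_cellOf (m n))
      (fun y => ∀ p < k n, ∀ q < k n,
        (badCells (fun c => μ n / 4 < cellCount y c) (2 * ℓ) p q).card < ℓ)
      (fun y i => longRoutes (m n) (H n) (r n) (96 * ℓ) y i) (m := (H n : ℝ) ^ 2 * μ n / κ)
      (by positivity) (fun y hy => sum_longRoutes_ge (by omega) hn.k_pos hn.m_eq hn.r_pos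
        hn.three_le hn.le_four hn.mean_eq (by linarith) (hH n) hHk y hy)
    refine (measure_mono ?_).trans (h1.trans (ENNReal.ofReal_le_ofReal (exp_le_exp.mpr ?_)))
    · intro ω hω
      simp only [Set.mem_ofPred_eq, Classical.not_imp, not_lt] at hω ⊢
      exact hω
    · have h2 : 1 ≤ (H n : ℝ) ^ 2 := one_le_pow₀ hH'
      rw [neg_le_neg_iff]
      calc 1 / (51 * κ * 4) * Real.log n = 1 * (Real.log n / 51) / κ / 4 := by field_simp
        _ ≤ (H n : ℝ) ^ 2 * μ n / κ / 4 := by gcongr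
  refine ((h.and (whp_badCells hℓ hs)).and whp_unitSquare).mono ?_
  filter_upwards [hs, eventually_ge_atTop 1] with n hn hn1 ω hω
  have hn' : (0 : ℝ) < n := by exact_mod_cast hn1
  refine le_trans ?_ (le_avgDelayAdHoc (m := m n) (A := 96 * ℓ) (by positivity) hc₁.le (hd n ω) hω.2)
  have h1 := (hω.1.1 hω.1.2).le
  have h2 := hn.log_le
  calc _ = (H n : ℝ) ^ 2 * (Real.log n / 51) / κ / 4 * (H n / (96 * ℓ) * c₁) / n := by
        field_simp; ring
    _ ≤ (H n : ℝ) ^ 2 * μ n / κ / 4 * (H n / (96 * ℓ) * c₁) / n := by gcongr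
    _ ≤ _ := by gcongr

/-! ### The average delay of infrastructure communications -/

theorem eventually_log_le_mul {δ : ℝ} (hδ : 0 < δ) :
    ∀ᶠ n : ℕ in atTop, 2 * Real.log n ≤ n * δ := by
  filter_upwards [tendsto_log_div_natCast.eventually_lt_const (half_pos hδ), eventually_ge_atTop 1]
    with n hn hn1
  have hn' : (0 : ℝ) < n := by exact_mod_cast hn1
  rw [div_lt_iff₀ hn'] at hn
  linarith

/-- Every grid cell has at least `n * ε / 8` nodes too far away for ad hoc mode; given the
positions, at least `n * ε / 32` flows choose such a destination. -/
theorem whp_le_avgDelayInfra {K ε c : ℝ} (hε : 0 < ε) (hc : 0 ≤ c) {ℓ : ℕ} {k m : ℕ → ℕ}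
    {r μ θ : ℕ → ℝ} (hs : ∀ᶠ n in atTop, GridScale K ℓ n (k n) (m n) (r n) (μ n))
    {H b C : ℕ → ℕ} (hC : ∀ n, 1 ≤ C n) (hb : ∀ n, 1 ≤ b n) (hθ : ∀ n, 0 < θ n ∧ θ n ≤ π)
    (hfar : ∀ᶠ n in atTop, π * (H n * r n + 3 / m n) ^ 2 ≤ 1 - ε / 2) :
    Whp fun n ω => (ε / 32) ^ 2 * (c / (⌊2 * π / θ n⌋₊ * C n : ℕ)) ≤
      avgDelayInfra (r n) (H n) (b n) (C n) (θ n) c ω := by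
  have hpos : Whp fun n ω => ∀ q ∈ gridCells (m n), (n * (ε / 2)) / 4 <
      (({i | FarCell (m n) (H n) (r n) q (cellOf (m n) (ω.1 i))} : Set (Fin n)).ncard : ℝ) := by
    refine whp_of_le (tendsto_const_div_natCast 1) ?_
    filter_upwards [hs, hfar, eventually_ge_atTop 1,
      eventually_log_le_mul (show 0 < ε / 8 by positivity)] with n hn hf hn1 hlog
    have h1 := netLaw_positions_lower (n := n) (gridCells (m n))
      (fun q => {z | FarCell (m n) (H n) (r n) q (cellOf (m n) z)})
      (fun q _ => measurable_cellOf _ (Set.to_countable {c' | FarCell (m n) (H n) (r n) q c'}).measurableSet)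
      (μ := n * (ε / 2)) (by positivity) (fun q _ => by
        gcongr
        exact restrict_unitSquare_farCell hn.m_pos hn.r_pos.le hf q)
    refine (measure_mono ?_).trans (h1.trans (card_mul_exp_le hn1 ?_ ?_))
    · intro ω hω
      simp only [Set.mem_ofPred_eq, not_forall, not_lt] at hω ⊢
      obtain ⟨q, hq, hle⟩ := hω
      exact ⟨q, hq, hle⟩
    · rw [card_gridCells, one_mul]; exact_mod_cast hn.sq_le
    · linarith
  have hflow : Whp fun n ω => ((∀ i, cellOf (m n) (ω.1 i) ∈ gridCells (m n)) ∧
      ∀ q ∈ gridCells (m n), (n * (ε / 2)) / 4 <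
      (({i | FarCell (m n) (H n) (r n) q (cellOf (m n) (ω.1 i))} : Set (Fin n)).ncard : ℝ)) →
      (n * (ε / 2)) / 4 / 4 < (({i | ω.2 i ∈ {j | FarCell (m n) (H n) (r n) (cellOf (m n) (ω.1 i))
        (cellOf (m n) (ω.1 j))}} : Set (Fin n)).ncard : ℝ) := by
    refine whp_of_le (tendsto_const_div_natCast 1) ?_
    filter_upwards [hs, eventually_ge_atTop 2,
      eventually_log_le_mul (show 0 < ε / 32 by positivity)] with n hn hn2 hlog
    have hn2' : (2 : ℝ) ≤ n := by exact_mod_cast hn2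
    have h1 := netLaw_flows_lower hn2 (measurable_cellOf (m n))
      (fun y => (∀ i, y i ∈ gridCells (m n)) ∧ ∀ q ∈ gridCells (m n), (n * (ε / 2)) / 4 <
        (({i | FarCell (m n) (H n) (r n) q (y i)} : Set (Fin n)).ncard : ℝ))
      (fun y i => {j | FarCell (m n) (H n) (r n) (y i) (y j)}) (m := (n * (ε / 2)) / 4)
      (by positivity) (by
        rintro y ⟨hy1, hy2⟩
        calc _ = ∑ _i : Fin n, (n * (ε / 2)) / 4 := by simp [mul_comm]
          _ ≤ _ := by
            refine Finset.sum_le_sum fun i _ => ?_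
            have hni : i ∉ {j | FarCell (m n) (H n) (r n) (y i) (y j)} := by
              have h0 := hn.r_pos
              have h00 := hn.m_pos
              simp only [FarCell, Set.mem_ofPred_eq, dist_self, not_lt]
              positivity
            rw [Set.sdiff_singleton_eq_self hni]
            exact (hy2 _ (hy1 i)).le)
    refine (measure_mono ?_).trans (h1.trans ?_)
    · intro ω hω
      simp only [Set.mem_ofPred_eq, Classical.not_imp, not_lt] at hω ⊢
      exact hω
    · have h2 := card_mul_exp_le (N := 1) (n := n) (B := 1) (t := (n * (ε / 2)) / 4 / 4) (by omega)
        (by push_cast; linarith) (by linarith)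
      rwa [Nat.cast_one, one_mul] at h2
  refine ((hflow.and hpos).and whp_unitSquare).mono ?_
  filter_upwards [hs, eventually_ge_atTop 1] with n hn hn1 ω hω
  have hn' : (0 : ℝ) < n := by exact_mod_cast hn1
  have h1 := hω.1.1 ⟨fun i => mem_gridCells.mpr (cellOf_lt hn.m_pos (hω.2 i)), hω.1.2⟩
  have h2 := le_avgDelayInfra (H := H n) (r := r n) (N := n * (ε / 32)) (hθ n).1 (hθ n).2 (hC n)
    (hb n) hn1 hc hω.2 (by positivity) (by
      refine le_trans (le_of_eq_of_le (by ring) h1.le) ?_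
      exact_mod_cast Set.ncard_le_ncard
        (fun i hi => not_isAdHoc_of_farCell hn.m_pos hn.r_pos.le hω.2 hi) (Set.toFinite _))
  rwa [mul_div_cancel_left₀ _ hn'.ne'] at h2

theorem whp_avgDelayInfra_le {c : ℝ} (hc : 0 ≤ c) {r θ : ℕ → ℝ}
    {H b C : ℕ → ℕ} (hC : ∀ n, 1 ≤ C n) (hb : ∀ n, 1 ≤ b n) (hθ : ∀ n, 0 < θ n ∧ θ n ≤ π)
    (hload : Tendsto (fun n : ℕ => (b n : ℝ) ^ 2 * (⌊2 * π / θ n⌋₊ * C n : ℕ) * Real.log n / n)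
      atTop (𝓝 0)) :
    Whp fun n ω => avgDelayInfra (r n) (H n) (b n) (C n) (θ n) c ω ≤
      132 * (c / (⌊2 * π / θ n⌋₊ * C n : ℕ)) := by
  set P : ℕ → ℕ := fun n => ⌊2 * π / θ n⌋₊ with hP
  have hP2 : ∀ n, 2 ≤ P n := fun n => (floor_beams (hθ n).1 (hθ n).2).1
  set Λ : ℕ → ℝ := fun n => n / ((b n : ℝ) ^ 2 * P n) with hΛ
  -- The load hypothesis in usable form: even the share of a single channel in a sector is at least
  -- `8 * log n`, and there are at most `2 * n` sectors in all.
  have hscale : ∀ᶠ n : ℕ in atTop, 2 ≤ n ∧ 2 ≤ Real.log n ∧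
      8 * Real.log n ≤ n / ((b n : ℝ) ^ 2 * (P n * C n : ℕ)) ∧
      8 * Real.log n ≤ Λ n ∧ ((2 * (b n ^ 2 * P n) : ℕ) : ℝ) ≤ 2 * n := by
    filter_upwards [hload.eventually_lt_const (show (0 : ℝ) < 1 / 8 by norm_num),
      eventually_ge_atTop 2, tendsto_log_natCast.eventually_ge_atTop 2] with n hn hn2 hlog
    have hn' : (0 : ℝ) < n := by exact_mod_cast (show 0 < n by omega)
    have hb' : (1 : ℝ) ≤ b n := by exact_mod_cast hb n
    have hC' : (1 : ℝ) ≤ C n := by exact_mod_cast hC n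
    have hP' : (2 : ℝ) ≤ P n := by exact_mod_cast hP2 n
    rw [div_lt_iff₀ hn'] at hn
    change (b n : ℝ) ^ 2 * (P n * C n : ℕ) * Real.log n < 1 / 8 * n at hn
    push_cast at hn ⊢
    have hle : (b n : ℝ) ^ 2 * P n ≤ (b n : ℝ) ^ 2 * (P n * C n) := by
      gcongr
      exact le_mul_of_one_le_right (by positivity) hC'
    have h1 : 8 * Real.log n ≤ n / ((b n : ℝ) ^ 2 * (P n * C n)) := by
      rw [le_div_iff₀ (by positivity)]
      linarith
    refine ⟨hn2, hlog, h1, h1.trans ?_, ?_⟩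
    · simp only [hΛ]
      gcongr
    · have h0 : (0 : ℝ) ≤ (b n : ℝ) ^ 2 * (P n * C n) := by positivity
      nlinarith
  set J : ℕ → Finset ((ℕ × ℕ) × ℕ) := fun n => gridCells (b n) ×ˢ Finset.range (2 * P n) with hJ
  have hJcard : ∀ n, (J n).card = 2 * (b n ^ 2 * P n) := by
    intro n
    simp only [hJ, Finset.card_product, card_gridCells, Finset.card_range]
    ring
  have hmemJ : ∀ n z, z ∈ unitSquare → bsSector (b n) (P n) z ∈ J n := by
    intro n z hz
    simp only [hJ, bsSector, Finset.mem_product, Finset.mem_range]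
    exact ⟨mem_gridCells.mpr (cellOf_lt (hb n) hz),
      (sectorIndex_bounds (by have := hP2 n; omega) _).1⟩
  have hpos : Whp fun n ω => ∀ s ∈ J n,
      (({i | bsSector (b n) (P n) (ω.1 i) = s} : Set (Fin n)).ncard : ℝ) < 4 * Λ n := by
    refine whp_of_le (tendsto_const_div_natCast 2) ?_
    filter_upwards [hscale] with n hn
    have h1 := netLaw_positions_upper (n := n) (J n) (fun s => {z | bsSector (b n) (P n) z = s})
      (fun s _ => measurable_bsSector _ _ (measurableSet_singleton s)) (μ := Λ n) (by
        intro s _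
        rw [bsSector_fiber]
        calc _ ≤ (n : ℝ) * (1 / ((b n : ℝ) ^ 2 * P n)) := by
              gcongr
              exact restrict_unitSquare_sector (hb n) (by have := hP2 n; omega) _ _
          _ = _ := by simp only [hΛ]; ring)
    refine (measure_mono ?_).trans (h1.trans (card_mul_exp_le (by omega) ?_ ?_))
    · intro ω hω
      simp only [Set.mem_ofPred_eq, not_forall, not_lt] at hω ⊢
      obtain ⟨q, hq, hle⟩ := hω
      exact ⟨q, hq, hle⟩
    · rw [hJcard]; exact hn.2.2.2.2
    · linarith [hn.2.2.2.1]
  have hpos' : Whp fun n ω => ∀ s,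
      (({i | bsSector (b n) (P n) (ω.1 i) = s} : Set (Fin n)).ncard : ℝ) ≤ 4 * Λ n := by
    refine (hpos.and whp_unitSquare).mono (Eventually.of_forall fun n ω hω s => ?_)
    by_cases hs : s ∈ J n
    · exact (hω.1 s hs).le
    · have h0 : ({i | bsSector (b n) (P n) (ω.1 i) = s} : Set (Fin n)) = ∅ := by
        ext i
        simp only [Set.mem_ofPred_eq, Set.mem_empty_iff_false, iff_false]
        rintro rfl
        exact hs (hmemJ n _ (hω.2 i))
      rw [h0, Set.ncard_empty, Nat.cast_zero]
      simp only [hΛ]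
      positivity
  have hflow : Whp fun n ω => ∀ s ∈ J n, (∀ s',
      (({i | bsSector (b n) (P n) (ω.1 i) = s'} : Set (Fin n)).ncard : ℝ) ≤ 4 * Λ n) →
      (({i | ω.2 i ∈ {j | bsSector (b n) (P n) (ω.1 j) = s}} : Set (Fin n)).ncard : ℝ) <
        4 * (8 * Λ n) := by
    refine whp_of_le (tendsto_const_div_natCast 2) ?_
    filter_upwards [hscale] with n hn
    have hn2' : (2 : ℝ) ≤ n := by exact_mod_cast hn.1
    have h1 := netLaw_biUnion_le (n := n) (J n) _ (fun s _ =>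
      netLaw_flows_upper hn.1 (measurable_bsSector (b n) (P n))
      (fun y => ∀ s', (({i | y i = s'} : Set (Fin n)).ncard : ℝ) ≤ 4 * Λ n)
      (fun y _ => {j | y j = s}) (m := 8 * Λ n) (by
        intro y hy
        have hΛ0 : 0 ≤ Λ n := by linarith [hn.2.1, hn.2.2.2.1]
        calc _ ≤ ∑ _i : Fin n, 4 * Λ n := Finset.sum_le_sum fun i _ => hy s
          _ = n * (4 * Λ n) := by simp
          _ ≤ _ := by nlinarith))
    refine (measure_mono ?_).trans (h1.trans ?_)
    · intro ω hω
      simp only [Set.mem_ofPred_eq, not_forall, not_lt] at hω ⊢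
      obtain ⟨q, hq, hle, hle'⟩ := hω
      exact ⟨q, hq, hle, hle'⟩
    · rw [neg_mul]
      refine card_mul_exp_le (by omega) ?_ ?_
      · rw [hJcard]; exact hn.2.2.2.2
      · linarith [hn.2.2.2.1, hn.2.1]
  have hmul : Whp fun n ω => ∀ j ∈ (Finset.univ : Finset (Fin n)),
      (({i | ω.2 i ∈ ({j} : Set (Fin n))} : Set (Fin n)).ncard : ℝ) < 4 * Real.log n := by
    refine whp_of_le (tendsto_const_div_natCast 1) ?_
    filter_upwards [hscale] with n hn
    have hn2' : (2 : ℝ) ≤ n := by exact_mod_cast hn.1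
    have h1 := netLaw_biUnion_le (n := n) Finset.univ _ (fun j _ =>
      -- The event does not involve the positions, so any discretization will do.
      netLaw_flows_upper hn.1 (measurable_cellOf 0) (fun _ => True) (fun _ _ => {j})
        (m := Real.log n) (by
        intro y _
        simp only [Set.ncard_singleton, Nat.cast_one, Finset.sum_const, Finset.card_univ,
          Fintype.card_fin, nsmul_eq_mul, mul_one]
        nlinarith [hn.2.1]))
    refine (measure_mono ?_).trans (h1.trans ?_)
    · intro ω hω
      simp only [Set.mem_ofPred_eq, not_forall, not_lt] at hω ⊢
      obtain ⟨q, hq, hle⟩ := hω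
      exact ⟨q, hq, trivial, hle⟩
    · rw [neg_mul]
      exact card_mul_exp_le (by omega) (by simp) le_rfl
  refine (((hflow.and hpos').and hmul).and whp_unitSquare).mono ?_
  filter_upwards [hscale] with n hn ω hω
  obtain ⟨hn2, hlog, hbig, hΛbig, -⟩ := hn
  obtain ⟨⟨⟨hω1, hω2⟩, hω3⟩, hω4⟩ := hω
  have hn' : (0 : ℝ) < n := by exact_mod_cast (show 0 < n by omega)
  have hb' : (0 : ℝ) < b n := by exact_mod_cast hb n
  have hC' : (0 : ℝ) < C n := by exact_mod_cast hC n
  have hP' : (0 : ℝ) < P n := by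
    have := hP2 n
    exact_mod_cast (show 0 < P n by omega)
  set t : ℝ := n / ((b n : ℝ) ^ 2 * (P n * C n : ℕ)) with ht
  have hCt : C n * t = Λ n := by
    simp only [ht, hΛ]; push_cast; field_simp
  have hT := Nat.le_ceil (32 * t)
  have hT2 := Nat.ceil_lt_add_one (a := 32 * t) (by linarith)
  -- `C * T` exceeds the sector loads, at most `4 * Λ` sources and `32 * Λ` flow destinations, and
  -- `T` exceeds the multiplicity `4 * log n`. Since `1 ≤ t`, `T ≤ 33 * t`, which gives `132 = 4 *
  -- 33`.
  set T := ⌈32 * t⌉₊ with hTdef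
  have hCT : 32 * Λ n ≤ ((C n * T : ℕ) : ℝ) := by
    push_cast
    rw [← hCt]
    nlinarith
  have hmain := avgDelayInfra_le (r := r n) (H := H n) (b := b n) (C := C n) (T := T) (hθ n).1
    (hθ n).2 (hC n) hc (by
      have : (1 : ℝ) ≤ T := by linarith
      exact_mod_cast this) (ω := ω)
    (fun s => by
      have h1 := hω2 s
      have h2 : (({i | bsSector (b n) (P n) (ω.1 i) = s} : Set (Fin n)).ncard : ℝ) ≤
        ((C n * T : ℕ) : ℝ) := by linarith
      exact_mod_cast h2)
    (fun s => by
      have h2 : (({i | bsSector (b n) (P n) (ω.1 (ω.2 i)) = s} : Set (Fin n)).ncard : ℝ) ≤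
          ((C n * T : ℕ) : ℝ) := by
        by_cases hs : s ∈ J n
        · have h1 := hω1 s hs hω2
          linarith
        · have h0 : ({i | bsSector (b n) (P n) (ω.1 (ω.2 i)) = s} : Set (Fin n)) = ∅ := by
            ext i
            simp only [Set.mem_ofPred_eq, Set.mem_empty_iff_false, iff_false]
            rintro rfl
            exact hs (hmemJ n _ (hω4 _))
          rw [h0, Set.ncard_empty, Nat.cast_zero]
          positivity
      exact_mod_cast h2)
    (fun j => by
      have h1 := hω3 j (Finset.mem_univ j)
      simp only [Set.mem_singleton_iff] at h1
      have h2 : (({i | ω.2 i = j} : Set (Fin n)).ncard : ℝ) ≤ T := by linarith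
      exact_mod_cast h2)
  refine hmain.trans ?_
  have hslot : 0 ≤ slotLength n (b n) c := by unfold slotLength; positivity
  calc 4 * (T : ℝ) * slotLength n (b n) c ≤ 4 * (33 * t) * slotLength n (b n) c := by
        gcongr
        linarith
    _ = 132 * (c / (P n * C n : ℕ)) := by
        simp only [ht, slotLength]; push_cast; field_simp; ring

/-! ### The average delay -/

theorem avgDelay_eq_add {n : ℕ} (r : ℝ) (H b₀ C : ℕ) (θ c : ℝ) (dwell : Fin n → ℕ → ℝ)
    (ω : Net n) : avgDelay r H b₀ C θ c dwell ω =
      avgDelayAdHoc r H dwell ω + avgDelayInfra r H b₀ C θ c ω := by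
  unfold avgDelay avgDelayAdHoc avgDelayInfra
  rw [← add_div, ← Finset.sum_add_distrib]
  congr 1
  refine Finset.sum_congr rfl fun i _ => ?_
  split_ifs <;> simp

theorem corollary2 (K ε c₁ c₂ : ℝ) (hK : 0 < K) (hε : 0 < ε) (hc₁ : 0 < c₁) (hc₂ : c₁ ≤ c₂) :
    ∃ a A : ℝ, 0 < a ∧ 0 < A ∧
      ∀ (c : ℝ) (r θ : ℕ → ℝ) (H b₀ C : ℕ → ℕ) (dwell : ∀ n : ℕ, Net n → Fin n → ℕ → ℝ),
        0 < c →
        (∀ n, 1 ≤ H n) → (∀ n, 1 ≤ b₀ n) → (∀ n, 1 ≤ C n) → (∀ n, 0 < θ n ∧ θ n ≤ π) →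
        (∀ n ω i k, c₁ ≤ dwell n ω i k ∧ dwell n ω i k ≤ c₂) →
        -- the transmission range is of the order needed for connectivity
        (∀ᶠ n : ℕ in atTop, √(Real.log n / (π * n)) < r n ∧ r n ≤ K * √(Real.log n / n)) →
        -- the proportion of infrastructure traffic does not vanish
        (∀ᶠ n : ℕ in atTop, π * ((H n : ℝ) * r n) ^ 2 ≤ 1 - ε) →
        -- there are enough nodes in every cell to load all sectors and channels
        Tendsto (fun n : ℕ =>
          (b₀ n : ℝ) ^ 2 * (⌊2 * π / θ n⌋₊ * C n : ℕ) * Real.log n / n) atTop (𝓝 0) →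
        (∀ n, IsGreatest (simultaneous (θ n) (C n)) (⌊2 * π / θ n⌋₊ * C n)) ∧
        Tendsto (fun n : ℕ => netLaw n {ω : Net n | ¬
          (avgDelay (r n) (H n) (b₀ n) (C n) (θ n) c (dwell n ω) ω =
              avgDelayAdHoc (r n) (H n) (dwell n ω) ω +
                avgDelayInfra (r n) (H n) (b₀ n) (C n) (θ n) c ω ∧
            a * ((H n : ℝ) ^ 3 * Real.log n / n) ≤ avgDelayAdHoc (r n) (H n) (dwell n ω) ω ∧
            avgDelayAdHoc (r n) (H n) (dwell n ω) ω ≤ A * ((H n : ℝ) ^ 3 * Real.log n / n) ∧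
            a * (c / (⌊2 * π / θ n⌋₊ * C n : ℕ)) ≤
              avgDelayInfra (r n) (H n) (b₀ n) (C n) (θ n) c ω ∧
            avgDelayInfra (r n) (H n) (b₀ n) (C n) (θ n) c ω ≤
              A * (c / (⌊2 * π / θ n⌋₊ * C n : ℕ)))}) atTop (𝓝 0) := by
  obtain ⟨ℓ, hℓ⟩ : ∃ ℓ : ℕ, 500 ≤ ℓ := ⟨500, le_rfl⟩
  have hℓ' : (500 : ℝ) ≤ ℓ := by exact_mod_cast hℓ
  set a₁ : ℝ := c₁ / (51 * 384 * ℓ * (48 ^ 2 * 256 * (ℓ : ℝ) ^ 4)) with ha₁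
  set A₁ : ℝ := 387200 * K ^ 2 / 9 * c₂ with hA₁
  refine ⟨min a₁ ((ε / 32) ^ 2), max A₁ 132, lt_min (by positivity) (by positivity),
    lt_max_of_lt_right (by norm_num), ?_⟩
  intro c r θ H b₀ C dwell hc hH hb hC hθ hd hr hHr hload
  refine ⟨fun n => isGreatest_simultaneous (hθ n).1 (hθ n).2, ?_⟩
  obtain ⟨k, m, μ, hs⟩ := eventually_gridScale (ℓ := ℓ) (by omega) hr
  have hHr1 : ∀ᶠ n in atTop, H n * r n ≤ 1 := by
    filter_upwards [hHr] with n hn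
    nlinarith [pi_gt_three]
  -- Discretization enlarges the radius by `3 / m ≤ r`, which tends to zero and costs at most half
  -- of `ε`: `4 * r * (2 + 1) < ε / 2` once `r < ε / 24`.
  have hfar : ∀ᶠ n in atTop, π * (H n * r n + 3 / m n) ^ 2 ≤ 1 - ε / 2 := by
    filter_upwards [hs, hHr, hHr1, eventually_range_lt hr (δ := min 1 (ε / 24)) (by positivity)]
      with n hn h1 h2 h3
    have hm' : (0 : ℝ) < m n := by exact_mod_cast hn.m_pos
    have h4 : 3 / (m n : ℝ) ≤ r n := by
      rw [div_le_iff₀ hm']; linarith [hn.three_le]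
    have h5 : r n < 1 := h3.2.trans_le (min_le_left _ _)
    have h6 : r n < ε / 24 := h3.2.trans_le (min_le_right _ _)
    have h7 : 0 < r n := h3.1
    calc π * (H n * r n + 3 / m n) ^ 2 ≤ π * (H n * r n + r n) ^ 2 := by gcongr
      _ = π * (H n * r n) ^ 2 + π * (r n * (2 * (H n * r n) + r n)) := by ring
      _ ≤ (1 - ε) + 4 * (r n * (2 * 1 + 1)) := by
        gcongr
        exact pi_le_four
      _ ≤ 1 - ε / 2 := by linarith
  have hmain := (((whp_le_avgDelayAdHoc hc₁ hℓ hs hH hHr1 hd).and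
    (whp_avgDelayAdHoc_le (hc₁.le.trans hc₂) hs hH hd)).and
    (whp_le_avgDelayInfra hε hc.le hs hC hb hθ hfar)).and
    (whp_avgDelayInfra_le (r := r) (H := H) hc.le hC hb hθ hload)
  refine hmain.mono (F := fun n ω => _) (Eventually.of_forall fun n ω hω => ?_)
  obtain ⟨⟨⟨h1, h2⟩, h3⟩, h4⟩ := hω
  have hlog : 0 ≤ (H n : ℝ) ^ 3 * Real.log n / n := by positivity
  have hcM : 0 ≤ c / (⌊2 * π / θ n⌋₊ * C n : ℕ) := by positivity
  exact ⟨avgDelay_eq_add _ _ _ _ _ _ _ _,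
    (mul_le_mul_of_nonneg_right (min_le_left _ _) hlog).trans h1,
    h2.trans (mul_le_mul_of_nonneg_right (le_max_left _ _) hlog),
    (mul_le_mul_of_nonneg_right (min_le_right _ _) hcM).trans h3,
    h4.trans (mul_le_mul_of_nonneg_right (le_max_right _ _) hcM)⟩
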